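/- For a finite simple graph $G$ on $n$ vertices with adjacency eigenvalues $\lambda_1,\dots,\lambda_n$ (counted with multiplicity), let $ER(G)=\sum_{i=1}^n \frac{1}{n-\lambda_i}$ be its resolvent energy. A graph is called unicyclic if it is connected and has as many edges as vertices (equivalently, it is connected and contains exactly one cycle). For $n\ge 4$ let $X_n$ be the graph obtained from the cycle $C_3$ by attaching $n-3$ pendent vertices to one of its vertices, and let $\tilde X_n$ be the graph obtained from the cycle $C_4$ by attaching $n-4$ pendent vertices to one of its vertices. Let $G$ be a unicyclic graph on $n\ge 4$ vertices. Then $ER(G)\le ER(X_n)$, with equality if and only if $G\cong X_n$. Moreover, if $G$ is bipartite, then $ER(G)\le ER(\tilde X_n)$, with equality if and only if $G\cong\tilde X_n$. -/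

import Mathlib

namespace ResolventEnergy

/-- A finite graph is unicyclic if it is connected with as many edges as vertices
(cyclomatic number `1`, that is, exactly one cycle). -/
def IsUnicyclic {V : Type*} [Fintype V] [DecidableEq V] (G : SimpleGraph V)
    [DecidableRel G.Adj] : Prop :=
  G.Connected ∧ G.edgeFinset.card = Fintype.card V

theorem adjMatrix_isHermitian {V : Type*} (G : SimpleGraph V) [DecidableRel G.Adj] :
    (G.adjMatrix ℝ).IsHermitian := by
  rw [Matrix.IsHermitian, Matrix.conjTranspose_eq_transpose_of_trivial]
  exact G.isSymm_adjMatrix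

/-- The resolvent energy `∑ᵢ 1 / (n - λᵢ)` of a graph on `n` vertices, where `λ₁, …, λₙ` are the
eigenvalues of the adjacency matrix, listed with multiplicity. -/
noncomputable def ER {V : Type*} [Fintype V] [DecidableEq V] (G : SimpleGraph V)
    [DecidableRel G.Adj] : ℝ :=
  ∑ i : V, 1 / ((Fintype.card V : ℝ) - (adjMatrix_isHermitian G).eigenvalues i)

/-- Adjacency of the cycle `C_k` (vertices `Sum.inl i`) with `m` pendent vertices
(`Sum.inr p`), all attached to the cycle vertex `0`. -/
def cycleWithPendentsAdj (k m : ℕ) : Fin k ⊕ Fin m → Fin k ⊕ Fin m → Prop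
  | .inl i, .inl j => (SimpleGraph.cycleGraph k).Adj i j
  | .inl i, .inr _ => i.val = 0
  | .inr _, .inl j => j.val = 0
  | .inr _, .inr _ => False

/-- The cycle `C_k` with `m` pendent vertices attached to one of its vertices. -/
def cycleWithPendents (k m : ℕ) : SimpleGraph (Fin k ⊕ Fin m) where
  Adj := cycleWithPendentsAdj k m
  symm := ⟨by
    rintro (i | i) (j | j) h
    · exact SimpleGraph.Adj.symm h
    · exact h
    · exact h
    · exact h⟩
  loopless := ⟨by
    rintro (i | i) h
    · exact SimpleGraph.irrefl _ h
    · exact h⟩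

instance (k m : ℕ) : DecidableRel (cycleWithPendents k m).Adj
  | .inl i, .inl j => inferInstanceAs (Decidable ((SimpleGraph.cycleGraph k).Adj i j))
  | .inl i, .inr _ => inferInstanceAs (Decidable (i.val = 0))
  | .inr _, .inl j => inferInstanceAs (Decidable (j.val = 0))
  | .inr _, .inr _ => inferInstanceAs (Decidable False)

/-- `X_n`: the triangle with `n - 3` pendent vertices attached to one vertex (for `3 ≤ n`). -/
abbrev X (n : ℕ) : SimpleGraph (Fin 3 ⊕ Fin (n - 3)) := cycleWithPendents 3 (n - 3)

/-- `X̃_n`: the 4-cycle with `n - 4` pendent vertices attached to one vertex (for `4 ≤ n`). -/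
abbrev XTilde (n : ℕ) : SimpleGraph (Fin 4 ⊕ Fin (n - 4)) := cycleWithPendents 4 (n - 4)

end ResolventEnergy

/-! Write `d v` for degrees and `A` for the adjacency matrix. Expanding `1/(n - λ)` in powers of `λ`
turns the resolvent energy into a weighted sum of closed-walk counts `tr A^k`. For a unicyclic graph
`tr A` and `tr A²` are fixed, `tr A³` only records whether the cycle is a triangle, and `tr A⁴` is
governed by `∑ d²`. A nearly universal vertex therefore wins, and a smaller maximum degree costs an
amount of order `n` in `tr A⁴`.

The upper bound truncates the series: terms of order four and five keep a common denominator `n² -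
Y`, where `Y` bounds all `λ²` (`ER_le_of_row_sum_sq_le`). Writing the graph as a spanning tree plus
one edge, and using uniqueness of paths in the tree, gives the traces up to order five and `Y = n +
c`, with `c` the number of triangles (`IsUnicyclic.moment_bounds`).

The excesses `d - 1` are nonnegative with sum `n`. Edge counting bounds their pair sums (and, for
bipartite graphs, triple sums), so a restriction on the maximum degree bounds `∑ d²`. For the two
extremal graphs the nonzero eigenvalues are roots of a quartic, which gives the energy in closed
form (`ER_X`, `ER_XTilde`). Comparing rational functions of `n` yields strict inequality whenever no
vertex has degree `n - 1` (respectively `n - 2`). A vertex of that degree forces the extremal graph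
(`IsUnicyclic.nonempty_iso_X`, `IsUnicyclic.nonempty_iso_XTilde`). -/

namespace ResolventEnergy

open Matrix

/-! ### Traces of powers and a bound on squared eigenvalues -/

section Spectral

variable {V : Type*} [Fintype V] [DecidableEq V]

theorem trace_pow_eq_sum_eigenvalues_pow {A : Matrix V V ℝ} (hA : A.IsHermitian) (k : ℕ) :
    (A ^ k).trace = ∑ i, hA.eigenvalues i ^ k := by
  have h := hA.spectral_theorem
  rw [Unitary.conjStarAlgAut_apply] at h
  have hk : A ^ k = (hA.eigenvectorUnitary : Matrix V V ℝ) *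
      (diagonal (RCLike.ofReal ∘ hA.eigenvalues)) ^ k *
        (star hA.eigenvectorUnitary : Matrix V V ℝ) := by
    conv_lhs => rw [h]
    induction k with
    | zero => simp
    | succ k ih =>
      rw [pow_succ, ih, pow_succ]
      have hU : (star hA.eigenvectorUnitary : Matrix V V ℝ) *
          (hA.eigenvectorUnitary : Matrix V V ℝ) = 1 := by simp
      simp only [Matrix.mul_assoc]
      rw [← Matrix.mul_assoc (star _ : Matrix V V ℝ), hU, Matrix.one_mul]
  rw [hk, Matrix.trace_mul_cycle, diagonal_pow]
  simp [Matrix.trace]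

theorem exists_eigenvector {A : Matrix V V ℝ} (hA : A.IsHermitian) (i : V) :
    ∃ f : V → ℝ, f ≠ 0 ∧ ∀ a, ∑ b, A a b * f b = hA.eigenvalues i * f a := by
  refine ⟨(hA.eigenvectorBasis i).ofLp, ?_, fun a => ?_⟩
  · intro h
    have := hA.eigenvectorBasis.orthonormal.ne_zero i
    exact this (by ext j; simpa using congrFun h j)
  · have := congrFun (hA.mulVec_eigenvectorBasis i) a
    simpa [mulVec, dotProduct] using this

/-- Evaluate `A² f = λ² f` at a coordinate where `|f|` is largest. Passing to `A²` matters: its row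
sums are about `n` here, while those of `A` would only give `λ² ≤ Δ²`, with `Δ` the maximum degree.
-/
theorem eigenvalues_sq_le_of_row_sum_sq_le {A : Matrix V V ℝ} (hA : A.IsHermitian)
    (h0 : ∀ a b, 0 ≤ A a b) {Y : ℝ} (hY : ∀ a, ∑ b, (A * A) a b ≤ Y) (i : V) :
    hA.eigenvalues i ^ 2 ≤ Y := by
  obtain ⟨f, hf, he⟩ := exists_eigenvector hA i
  have he2 : ∀ a, ∑ b, (A * A) a b * f b = hA.eigenvalues i ^ 2 * f a := by
    intro a
    simp only [Matrix.mul_apply, Finset.sum_mul]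
    rw [Finset.sum_comm]
    simp only [mul_assoc]
    simp only [← Finset.mul_sum, he]
    simp only [mul_left_comm (A a _), ← Finset.mul_sum, he]
    ring
  have : Nonempty V := ⟨i⟩
  obtain ⟨m, hm⟩ := Finite.exists_max (fun a => |f a|)
  have hpos : 0 < |f m| := by
    obtain ⟨a, ha⟩ := Function.ne_iff.mp hf
    exact lt_of_lt_of_le (abs_pos.mpr ha) (hm a)
  have hnn : ∀ a b, 0 ≤ (A * A) a b := fun a b =>
    Finset.sum_nonneg fun c _ => mul_nonneg (h0 _ _) (h0 _ _)
  have : hA.eigenvalues i ^ 2 * |f m| ≤ Y * |f m| := by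
    calc hA.eigenvalues i ^ 2 * |f m| = |∑ b, (A * A) m b * f b| := by
          rw [he2, abs_mul, abs_of_nonneg (sq_nonneg (hA.eigenvalues i))]
      _ ≤ ∑ b, |(A * A) m b * f b| := Finset.abs_sum_le_sum_abs _ _
      _ ≤ ∑ b, (A * A) m b * |f m| := Finset.sum_le_sum fun b _ => by
          rw [abs_mul, abs_of_nonneg (hnn m b)]
          exact mul_le_mul_of_nonneg_left (hm b) (hnn m b)
      _ ≤ Y * |f m| := by
          rw [← Finset.sum_mul]
          exact mul_le_mul_of_nonneg_right (hY m) hpos.le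
  exact le_of_mul_le_mul_right this hpos

end Spectral

/-! ### Upper bound for the energy by moments of order at most five -/

section Energy

variable {V W : Type*} [Fintype V] [DecidableEq V] [Fintype W] [DecidableEq W]

theorem ER_eq_sum_roots (G : SimpleGraph V) [DecidableRel G.Adj] :
    ER G = ((G.adjMatrix ℝ).charpoly.roots.map
      fun x => 1 / ((Fintype.card V : ℝ) - x)).sum := by
  rw [(adjMatrix_isHermitian G).roots_charpoly_eq_eigenvalues]
  rw [Multiset.map_map]
  rfl

theorem ER_congr {G : SimpleGraph V} [DecidableRel G.Adj] {H : SimpleGraph W}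
    [DecidableRel H.Adj] (e : G ≃g H) : ER G = ER H := by
  rw [ER_eq_sum_roots, ER_eq_sum_roots, ← e.reindex_adjMatrix ℝ, charpoly_reindex,
    Fintype.card_congr e.toEquiv]

/-- The geometric series cut after order three has remainder `l⁴ (n + l) / (n⁴ (n² - l²))`. Since
`|l| < n`, its numerator is nonnegative, so `l²` may be replaced by `Y` in the denominator; the
result is a polynomial in `l` and can be summed by traces. -/
theorem one_div_sub_le_of_sq_le {n l Y : ℝ} (hn : 0 < n) (hl : l ^ 2 ≤ Y) (hY : Y < n ^ 2) :
    1 / (n - l) ≤ 1 / n + l / n ^ 2 + l ^ 2 / n ^ 3 + l ^ 3 / n ^ 4 +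
      (n * l ^ 4 + l ^ 5) / (n ^ 4 * (n ^ 2 - Y)) := by
  have h1 := abs_lt_of_sq_lt_sq (hl.trans_lt hY) hn.le
  rw [abs_lt] at h1
  have hnl : 0 < n - l := by linarith
  have hnl' : 0 < n + l := by linarith
  have hd : 0 < n ^ 2 - Y := by linarith
  have key : (n * l ^ 4 + l ^ 5) / (n ^ 4 * (n ^ 2 - l ^ 2)) ≤
      (n * l ^ 4 + l ^ 5) / (n ^ 4 * (n ^ 2 - Y)) := by
    apply div_le_div_of_nonneg_left
    · have : n * l ^ 4 + l ^ 5 = l ^ 4 * (n + l) := by ring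
      rw [this]; positivity
    · positivity
    · apply mul_le_mul_of_nonneg_left _ (by positivity); linarith
  have e : 1 / (n - l) = 1 / n + l / n ^ 2 + l ^ 2 / n ^ 3 + l ^ 3 / n ^ 4 +
      (n * l ^ 4 + l ^ 5) / (n ^ 4 * (n ^ 2 - l ^ 2)) := by
    have : n ^ 2 - l ^ 2 = (n - l) * (n + l) := by ring
    rw [this]
    field_simp
    ring
  linarith

theorem ER_le_of_row_sum_sq_le (G : SimpleGraph V) [DecidableRel G.Adj] {n Y : ℝ}
    (hn : (Fintype.card V : ℝ) = n) (hpos : 0 < n)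
    (hY : ∀ a, ∑ b, (G.adjMatrix ℝ * G.adjMatrix ℝ) a b ≤ Y) (hYn : Y < n ^ 2) :
    ER G ≤ 1 + (G.adjMatrix ℝ ^ 2).trace / n ^ 3 + (G.adjMatrix ℝ ^ 3).trace / n ^ 4 +
      (n * (G.adjMatrix ℝ ^ 4).trace + (G.adjMatrix ℝ ^ 5).trace) / (n ^ 4 * (n ^ 2 - Y)) := by
  have hA := adjMatrix_isHermitian G
  have h0 : ∀ a b, 0 ≤ G.adjMatrix ℝ a b := fun a b => by
    rw [SimpleGraph.adjMatrix_apply]; split_ifs <;> norm_num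
  have ht : ∑ i, hA.eigenvalues i = 0 := by
    have := trace_pow_eq_sum_eigenvalues_pow hA 1
    simpa using this.symm
  have h := Finset.sum_le_sum fun i (_ : i ∈ Finset.univ) => one_div_sub_le_of_sq_le hpos
    (eigenvalues_sq_le_of_row_sum_sq_le hA h0 hY i) hYn
  simp only [Finset.sum_add_distrib, ← Finset.sum_div, ← Finset.mul_sum, ht,
    ← trace_pow_eq_sum_eigenvalues_pow, Finset.sum_const, Finset.card_univ, nsmul_eq_mul, hn] at h
  have hone : n * 1 / n = 1 := by field_simp
  rw [hone, zero_div, add_zero] at h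
  simpa only [ER, hn] using h

end Energy

/-! ### Exact energies of the extremal graphs -/

section Extremal

variable {V : Type*} [Fintype V] [DecidableEq V]

/-- Let `ψ(t) = t⁴ - n t² - a t + b`. Where `l ψ(l) = 0`, the polynomial `(n ψ(n) - l ψ(l)) / (n -
l)` divided by `n ψ(n)` equals `1 / (n - l)`. So the energy depends only on traces up to order four,
and eigenvalue multiplicities are not needed. -/
theorem ER_eq_of_eigenvalues_root (G : SimpleGraph V) [DecidableRel G.Adj] {n a b : ℝ}
    (hn : (Fintype.card V : ℝ) = n) (hpos : 0 < n) (hψ : 0 < n ^ 4 - n ^ 3 - a * n + b)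
    (hroot : ∀ i, (adjMatrix_isHermitian G).eigenvalues i *
      ((adjMatrix_isHermitian G).eigenvalues i ^ 4 - n * (adjMatrix_isHermitian G).eigenvalues i ^ 2
        - a * (adjMatrix_isHermitian G).eigenvalues i + b) = 0) :
    ER G = 1 + ((G.adjMatrix ℝ ^ 4).trace + n * (G.adjMatrix ℝ ^ 3).trace +
      (n ^ 2 - n) * (G.adjMatrix ℝ ^ 2).trace) / (n * (n ^ 4 - n ^ 3 - a * n + b)) := by
  have hA := adjMatrix_isHermitian G
  have ht : ∑ i, hA.eigenvalues i = 0 := by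
    have := trace_pow_eq_sum_eigenvalues_pow hA 1
    simpa using this.symm
  have key : ∀ i, 1 / (n - hA.eigenvalues i) = 1 / n + (hA.eigenvalues i ^ 4 +
      n * hA.eigenvalues i ^ 3 + (n ^ 2 - n) * hA.eigenvalues i ^ 2 +
      (n ^ 3 - n ^ 2 - a) * hA.eigenvalues i) / (n * (n ^ 4 - n ^ 3 - a * n + b)) := by
    intro i
    have hi := hroot i
    generalize hA.eigenvalues i = l at hi ⊢
    have hne : n - l ≠ 0 := by
      intro h
      obtain rfl : n = l := by linarith
      rcases mul_eq_zero.mp hi with h | h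
      · exact hpos.ne' h
      · apply hψ.ne'; linear_combination h
    have hψ' := hψ.ne'
    rw [div_add_div _ _ hpos.ne' (by positivity), div_eq_div_iff hne (by positivity)]
    linear_combination n * hi
  simp only [ER, hn]
  rw [Finset.sum_congr rfl fun i _ => key i]
  simp only [Finset.sum_add_distrib, ← Finset.sum_div, ← Finset.mul_sum, ht,
    ← trace_pow_eq_sum_eigenvalues_pow, Finset.sum_const, Finset.card_univ, nsmul_eq_mul, hn]
  rw [mul_one, div_self hpos.ne', mul_zero, add_zero]

theorem trace_sq_eq (G : SimpleGraph V) [DecidableRel G.Adj] :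
    (G.adjMatrix ℝ ^ 2).trace = ∑ a, ∑ b, G.adjMatrix ℝ a b := by
  rw [pow_two]
  refine Finset.sum_congr rfl fun a _ => ?_
  rw [diag_apply, Matrix.mul_apply]
  refine Finset.sum_congr rfl fun b _ => ?_
  simp [SimpleGraph.adjMatrix_apply, G.adj_comm b a]

theorem trace_cube_eq (G : SimpleGraph V) [DecidableRel G.Adj] :
    (G.adjMatrix ℝ ^ 3).trace =
      ∑ a, ∑ b, (G.adjMatrix ℝ * G.adjMatrix ℝ) a b * G.adjMatrix ℝ a b := by
  rw [pow_succ, pow_two]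
  refine Finset.sum_congr rfl fun a _ => ?_
  rw [diag_apply, Matrix.mul_apply]
  refine Finset.sum_congr rfl fun b _ => ?_
  rw [G.isSymm_adjMatrix.apply]

theorem trace_fourth_eq (G : SimpleGraph V) [DecidableRel G.Adj] :
    (G.adjMatrix ℝ ^ 4).trace = ∑ a, ∑ b, (G.adjMatrix ℝ * G.adjMatrix ℝ) a b ^ 2 := by
  have h4 : G.adjMatrix ℝ ^ 4 = (G.adjMatrix ℝ * G.adjMatrix ℝ) * (G.adjMatrix ℝ * G.adjMatrix ℝ) := by
    simp only [pow_succ, pow_zero, Matrix.one_mul, Matrix.mul_assoc]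
  rw [h4]
  refine Finset.sum_congr rfl fun a _ => ?_
  rw [diag_apply, Matrix.mul_apply]
  refine Finset.sum_congr rfl fun b _ => ?_
  have : (G.adjMatrix ℝ * G.adjMatrix ℝ) b a = (G.adjMatrix ℝ * G.adjMatrix ℝ) a b := by
    simp only [Matrix.mul_apply]
    refine Finset.sum_congr rfl fun c _ => ?_
    rw [mul_comm, G.isSymm_adjMatrix.apply a c, G.isSymm_adjMatrix.apply c b]
  rw [this, pow_two]

theorem adjMatrix_cycleWithPendents (k m : ℕ) :
    (cycleWithPendents k m).adjMatrix ℝ =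
      fromBlocks ((SimpleGraph.cycleGraph k).adjMatrix ℝ) (of fun i _ => if i.val = 0 then 1 else 0)
        (of fun _ j => if j.val = 0 then 1 else 0) 0 := by
  ext (i | i) (j | j) <;>
    rw [SimpleGraph.adjMatrix_apply] <;> simp [cycleWithPendents, cycleWithPendentsAdj] <;> congr

theorem adjMatrix_cycleGraph_three :
    (SimpleGraph.cycleGraph 3).adjMatrix ℝ = !![0, 1, 1; 1, 0, 1; 1, 1, 0] := by
  have h : ∀ i j : Fin 3, (SimpleGraph.cycleGraph 3).Adj i j ↔ i ≠ j := by decide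
  ext i j
  rw [SimpleGraph.adjMatrix_apply]
  fin_cases i <;> fin_cases j <;> simp [h]

theorem adjMatrix_cycleGraph_four :
    (SimpleGraph.cycleGraph 4).adjMatrix ℝ =
      !![0, 1, 0, 1; 1, 0, 1, 0; 0, 1, 0, 1; 1, 0, 1, 0] := by
  have h : ∀ i j : Fin 4, (SimpleGraph.cycleGraph 4).Adj i j ↔ i.val % 2 ≠ j.val % 2 := by decide
  ext i j
  rw [SimpleGraph.adjMatrix_apply]
  fin_cases i <;> fin_cases j <;> simp [h]

theorem trace_sq_trianglePendents (m : ℕ) :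
    ((cycleWithPendents 3 m).adjMatrix ℝ ^ 2).trace = 2 * (m + 3) := by
  rw [trace_sq_eq, adjMatrix_cycleWithPendents, adjMatrix_cycleGraph_three]
  simp [Fintype.sum_sum_type, Fin.sum_univ_three]
  ring

theorem trace_cube_trianglePendents (m : ℕ) :
    ((cycleWithPendents 3 m).adjMatrix ℝ ^ 3).trace = 6 := by
  rw [trace_cube_eq, adjMatrix_cycleWithPendents, adjMatrix_cycleGraph_three]
  simp [Fintype.sum_sum_type, Fin.sum_univ_three, Matrix.mul_apply]
  ring

theorem trace_fourth_trianglePendents (m : ℕ) :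
    ((cycleWithPendents 3 m).adjMatrix ℝ ^ 4).trace = 2 * (m + 2) ^ 2 + 10 := by
  rw [trace_fourth_eq, adjMatrix_cycleWithPendents, adjMatrix_cycleGraph_three]
  simp [Fintype.sum_sum_type, Fin.sum_univ_three, Matrix.mul_apply]
  ring

theorem trace_sq_squarePendents (m : ℕ) :
    ((cycleWithPendents 4 m).adjMatrix ℝ ^ 2).trace = 2 * (m + 4) := by
  rw [trace_sq_eq, adjMatrix_cycleWithPendents, adjMatrix_cycleGraph_four]
  simp [Fintype.sum_sum_type, Fin.sum_univ_four]
  ring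

theorem trace_cube_squarePendents (m : ℕ) :
    ((cycleWithPendents 4 m).adjMatrix ℝ ^ 3).trace = 0 := by
  rw [trace_cube_eq, adjMatrix_cycleWithPendents, adjMatrix_cycleGraph_four]
  simp [Fintype.sum_sum_type, Fin.sum_univ_four, Matrix.mul_apply]

theorem trace_fourth_squarePendents (m : ℕ) :
    ((cycleWithPendents 4 m).adjMatrix ℝ ^ 4).trace = 2 * (m + 2) ^ 2 + 24 := by
  rw [trace_fourth_eq, adjMatrix_cycleWithPendents, adjMatrix_cycleGraph_four]
  simp [Fintype.sum_sum_type, Fin.sum_univ_four, Matrix.mul_apply]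
  ring

theorem eigenvalue_trianglePendents {m : ℕ} {f : Fin 3 ⊕ Fin m → ℝ} {l : ℝ} (hf : f ≠ 0)
    (he : ∀ a, ∑ b, (cycleWithPendents 3 m).adjMatrix ℝ a b * f b = l * f a) :
    l * (l ^ 4 - (m + 3) * l ^ 2 - 2 * l + m) = 0 := by
  rw [adjMatrix_cycleWithPendents, adjMatrix_cycleGraph_three] at he
  have e0 := he (.inl 0)
  have e1 := he (.inl 1)
  have e2 := he (.inl 2)
  have ep : ∀ p, f (.inl 0) = l * f (.inr p) := fun p => by
    have := he (.inr p)
    simpa [Fintype.sum_sum_type, Fin.sum_univ_three] using this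
  simp [Fintype.sum_sum_type, Fin.sum_univ_three] at e0 e1 e2
  by_cases hl : l = 0
  · simp [hl]
  have hs : l * ∑ p, f (.inr p) = m * f (.inl 0) := by
    rw [Finset.mul_sum, Finset.sum_congr rfl fun p _ => (ep p).symm]
    simp
  by_cases h0 : f (.inl 0) = 0
  · have hp : ∀ p, f (.inr p) = 0 := fun p => by
      have := ep p
      rw [h0, eq_comm, mul_eq_zero] at this
      exact this.resolve_left hl
    simp only [hp, Finset.sum_const_zero] at e0
    have h12 : f (.inl 1) ≠ 0 := by
      intro h1
      apply hf
      ext (i | p)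
      · fin_cases i
        · exact h0
        · exact h1
        · simp only [h0, h1, mul_zero] at e0
          simpa using e0
      · exact hp p
    -- An eigenvector vanishing at the centre is antisymmetric on the other two triangle vertices,
    -- so `l = -1`, a root of the quartic.
    have : (l + 1) * f (.inl 1) = 0 := by rw [h0] at e0 e1; linarith
    obtain h := (mul_eq_zero.mp this).resolve_right h12
    obtain rfl : l = -1 := by linarith
    ring
  -- Eliminating all other coordinates leaves a cubic; the quartic is this cubic times `l + 1`.
  · have : (l ^ 3 - l ^ 2 - (m + 2) * l + m) * f (.inl 0) = 0 := by
      linear_combination (-l * (l - 1)) * e0 + (-l) * e1 + (-l) * e2 + (l - 1) * hs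
    have := (mul_eq_zero.mp this).resolve_right h0
    linear_combination (l * (l + 1)) * this

/-- The term `0 * l` keeps the shape required by `ER_eq_of_eigenvalues_root`, with `a = 0`. -/
theorem eigenvalue_squarePendents {m : ℕ} {f : Fin 4 ⊕ Fin m → ℝ} {l : ℝ} (hf : f ≠ 0)
    (he : ∀ a, ∑ b, (cycleWithPendents 4 m).adjMatrix ℝ a b * f b = l * f a) :
    l * (l ^ 4 - (m + 4) * l ^ 2 - 0 * l + 2 * m) = 0 := by
  rw [adjMatrix_cycleWithPendents, adjMatrix_cycleGraph_four] at he
  have e0 := he (.inl 0)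
  have e1 := he (.inl 1)
  have e2 := he (.inl 2)
  have e3 := he (.inl 3)
  have ep : ∀ p, f (.inl 0) = l * f (.inr p) := fun p => by
    have := he (.inr p)
    simpa [Fintype.sum_sum_type, Fin.sum_univ_four] using this
  simp [Fintype.sum_sum_type, Fin.sum_univ_four] at e0 e1 e2 e3
  by_cases hl : l = 0
  · simp [hl]
  have hs : l * ∑ p, f (.inr p) = m * f (.inl 0) := by
    rw [Finset.mul_sum, Finset.sum_congr rfl fun p _ => (ep p).symm]
    simp
  by_cases h0 : f (.inl 0) = 0
  · have hp : ∀ p, f (.inr p) = 0 := fun p => by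
      have := ep p
      rw [h0, eq_comm, mul_eq_zero] at this
      exact this.resolve_left hl
    simp only [hp, Finset.sum_const_zero] at e0
    exfalso
    rw [h0] at e0 e1 e3
    have h2 : f (.inl 2) = 0 := by
      have : l * f (.inl 2) = 0 := by linarith
      exact (mul_eq_zero.mp this).resolve_left hl
    rw [h2] at e1 e3
    have h1 : f (.inl 1) = 0 := by
      have : l * f (.inl 1) = 0 := by linarith
      exact (mul_eq_zero.mp this).resolve_left hl
    have h3 : f (.inl 3) = 0 := by
      have : l * f (.inl 3) = 0 := by linarith
      exact (mul_eq_zero.mp this).resolve_left hl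
    apply hf
    ext (i | p)
    · fin_cases i
      exacts [h0, h1, h2, h3]
    · exact hp p
  · have : (l ^ 4 - (m + 4) * l ^ 2 + 2 * m) * f (.inl 0) = 0 := by
      linear_combination (-l * (l ^ 2 - 2)) * e0 + (-l ^ 2) * (e1 + e3) - 2 * l * e2 + (l ^ 2 - 2) * hs
    have := (mul_eq_zero.mp this).resolve_right h0
    linear_combination l * this

theorem ER_X {n : ℕ} (hn : 4 ≤ n) :
    ER (X n) = 1 + (2 * (n : ℝ) ^ 3 + 2 * n + 12) / (n * ((n : ℝ) ^ 4 - n ^ 3 - n - 3)) := by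
  obtain ⟨m, rfl⟩ : ∃ m, n = m + 3 := ⟨n - 3, by omega⟩
  have hm : (1 : ℝ) ≤ m := by exact_mod_cast (by omega : 1 ≤ m)
  have key := ER_eq_of_eigenvalues_root (cycleWithPendents 3 m) (n := (m : ℝ) + 3) (a := 2) (b := m)
    (by simp; ring) (by positivity) (by ring_nf; positivity) (fun i => by
      obtain ⟨f, hf, he⟩ := exists_eigenvector (adjMatrix_isHermitian (cycleWithPendents 3 m)) i
      exact eigenvalue_trianglePendents hf he)
  rw [trace_sq_trianglePendents, trace_cube_trianglePendents, trace_fourth_trianglePendents] at key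
  rw [show ER (X (m + 3)) = ER (cycleWithPendents 3 m) from rfl, key]
  push_cast
  congr 2 <;> ring

theorem ER_XTilde {n : ℕ} (hn : 4 ≤ n) :
    ER (XTilde n) =
      1 + (2 * (n : ℝ) ^ 3 - 8 * n + 32) / (n * ((n : ℝ) ^ 4 - n ^ 3 + 2 * n - 8)) := by
  obtain ⟨m, rfl⟩ : ∃ m, n = m + 4 := ⟨n - 4, by omega⟩
  have key := ER_eq_of_eigenvalues_root (cycleWithPendents 4 m) (n := (m : ℝ) + 4) (a := 0)
    (b := 2 * m) (by simp; ring) (by positivity) (by ring_nf; positivity) (fun i => by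
      obtain ⟨f, hf, he⟩ := exists_eigenvector (adjMatrix_isHermitian (cycleWithPendents 4 m)) i
      exact eigenvalue_squarePendents hf he)
  rw [trace_sq_squarePendents, trace_cube_squarePendents, trace_fourth_squarePendents] at key
  rw [show ER (XTilde (m + 4)) = ER (cycleWithPendents 4 m) from rfl, key]
  push_cast
  congr 2 <;> ring

end Extremal

/-! ### Sign vectors and weighted degree sums -/

section Basic

variable {V : Type*} (H : SimpleGraph V)

/-- The sign vector of a proper two-colouring. -/
theorem exists_sign_of_isBipartite {H : SimpleGraph V} (hH : H.IsBipartite) :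
    ∃ s : V → ℝ, (∀ a, s a = 1 ∨ s a = -1) ∧ ∀ a b, H.Adj a b → s a * s b = -1 := by
  obtain ⟨C⟩ := hH
  refine ⟨fun a => if C a = 0 then 1 else -1, fun a => ?_, fun a b hab => ?_⟩
  · dsimp only; split_ifs <;> simp
  · have := C.valid hab
    have h2 : ∀ i j : Fin 2, i ≠ j → (i = 0 ∧ j ≠ 0) ∨ (i ≠ 0 ∧ j = 0) := by decide
    rcases h2 _ _ this with ⟨h, h'⟩ | ⟨h, h'⟩ <;> simp [h, h']

variable [DecidableRel H.Adj]

theorem adjMatrix_nonneg (a b : V) : 0 ≤ H.adjMatrix ℝ a b := by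
  rw [SimpleGraph.adjMatrix_apply]; split_ifs <;> norm_num

theorem adjMatrix_le_one (a b : V) : H.adjMatrix ℝ a b ≤ 1 := by
  rw [SimpleGraph.adjMatrix_apply]; split_ifs <;> norm_num

variable [Fintype V]

theorem sum_adjMatrix_row (a : V) : ∑ b, H.adjMatrix ℝ a b = H.degree a := by
  simp [SimpleGraph.adjMatrix_apply, ← SimpleGraph.card_neighborFinset_eq_degree,
    SimpleGraph.neighborFinset_eq_filter]

theorem sum_degree_real : ∑ a, (H.degree a : ℝ) = 2 * H.edgeFinset.card := by
  exact_mod_cast H.sum_degrees_eq_twice_card_edges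

/-- Expand the nonnegative sum of `(1 - w a) * (1 - w b)` over adjacent pairs. Indicator vectors as
`w` bound sums of degrees; rows of the adjacency matrix bound row sums of its square. -/
theorem sum_mul_degree_le (w : V → ℝ) (h0 : ∀ a, w a ≤ 1) :
    ∑ a, w a * H.degree a ≤
      H.edgeFinset.card + (∑ a, ∑ b, w a * w b * H.adjMatrix ℝ a b) / 2 := by
  have h : 0 ≤ ∑ a, ∑ b, (1 - w a) * (1 - w b) * H.adjMatrix ℝ a b :=
    Finset.sum_nonneg fun a _ => Finset.sum_nonneg fun b _ =>
      mul_nonneg (mul_nonneg (sub_nonneg.2 (h0 a)) (sub_nonneg.2 (h0 b))) (adjMatrix_nonneg H a b)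
  have e1 : ∑ a, ∑ b, w a * H.adjMatrix ℝ a b = ∑ a, w a * H.degree a := by
    simp only [← Finset.mul_sum, sum_adjMatrix_row]
  have e2 : ∑ a, ∑ b, w b * H.adjMatrix ℝ a b = ∑ a, w a * H.degree a := by
    rw [Finset.sum_comm, ← e1]
    simp only [H.isSymm_adjMatrix.apply]
  have e3 : ∑ a, ∑ b, H.adjMatrix ℝ a b = 2 * H.edgeFinset.card := by
    simp only [sum_adjMatrix_row, sum_degree_real]
  have e : ∑ a, ∑ b, (1 - w a) * (1 - w b) * H.adjMatrix ℝ a b =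
      ∑ a, ∑ b, H.adjMatrix ℝ a b - ∑ a, ∑ b, w a * H.adjMatrix ℝ a b -
      ∑ a, ∑ b, w b * H.adjMatrix ℝ a b + ∑ a, ∑ b, w a * w b * H.adjMatrix ℝ a b := by
    simp only [← Finset.sum_sub_distrib, ← Finset.sum_add_distrib]
    refine Finset.sum_congr rfl fun a _ => Finset.sum_congr rfl fun b _ => ?_
    ring
  rw [e, e1, e2, e3] at h
  linarith

end Basic

/-! ### Walk counts in forests and bipartite graphs -/

section Forest

variable {V : Type*} [Fintype V] [DecidableEq V] (H : SimpleGraph V) [DecidableRel H.Adj]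

theorem adjMatrix_pow_nonneg (k : ℕ) (a b : V) : 0 ≤ (H.adjMatrix ℝ ^ k) a b := by
  rw [SimpleGraph.adjMatrix_pow_apply_eq_card_walk]; positivity

theorem adjMatrix_pow_symm (k : ℕ) (a b : V) :
    (H.adjMatrix ℝ ^ k) a b = (H.adjMatrix ℝ ^ k) b a := by
  have : ((H.adjMatrix ℝ ^ k)ᵀ) = H.adjMatrix ℝ ^ k := by
    rw [transpose_pow, SimpleGraph.transpose_adjMatrix]
  conv_lhs => rw [← this]
  rfl

/-- Matrix powers count walks, and a forest has at most one path between two vertices. -/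
theorem adjMatrix_pow_le_one_of_isPath {H : SimpleGraph V} [DecidableRel H.Adj]
    (hH : H.IsAcyclic) {k : ℕ} {u v : V} (hp : ∀ p : H.Walk u v, p.length = k → p.IsPath) :
    (H.adjMatrix ℝ ^ k) u v ≤ 1 := by
  rw [SimpleGraph.adjMatrix_pow_apply_eq_card_walk]
  norm_cast
  rw [Fintype.card_le_one_iff]
  rintro ⟨p, hp₁⟩ ⟨q, hq₁⟩
  have h : (⟨p, hp p hp₁⟩ : H.Path u v) = ⟨q, hp q hq₁⟩ := (hH.subsingleton_path u v).elim _ _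
  have h' : p = q := congrArg Subtype.val h
  subst h'
  rfl

theorem sq_apply_le_one {H : SimpleGraph V} [DecidableRel H.Adj] (hH : H.IsAcyclic) {u v : V}
    (huv : u ≠ v) : (H.adjMatrix ℝ ^ 2) u v ≤ 1 := by
  refine adjMatrix_pow_le_one_of_isPath hH ?_
  rintro (_ | ⟨h₁, _ | ⟨h₂, _ | ⟨h₃, p⟩⟩⟩) hp <;> simp at hp
  simp [SimpleGraph.Walk.isPath_def, huv, h₁.ne, h₂.ne]

theorem sq_apply_eq_zero_or_one {H : SimpleGraph V} [DecidableRel H.Adj] (hH : H.IsAcyclic)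
    {u v : V} (huv : u ≠ v) :
    (H.adjMatrix ℝ ^ 2) u v = 0 ∨ (H.adjMatrix ℝ ^ 2) u v = 1 := by
  have h1 := sq_apply_le_one hH huv
  obtain ⟨c, hc⟩ : ∃ c : ℕ, (H.adjMatrix ℝ ^ 2) u v = c :=
    ⟨_, SimpleGraph.adjMatrix_pow_apply_eq_card_walk _ _ _⟩
  rw [hc] at h1 ⊢
  norm_cast at h1 ⊢
  omega

theorem cube_apply_le_one {H : SimpleGraph V} [DecidableRel H.Adj] (hH : H.IsAcyclic) {u v : V}
    (huv : u ≠ v) (h : ¬ H.Adj u v) : (H.adjMatrix ℝ ^ 3) u v ≤ 1 := by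
  refine adjMatrix_pow_le_one_of_isPath hH ?_
  rintro (_ | ⟨h₁, _ | ⟨h₂, _ | ⟨h₃, _ | ⟨h₄, p⟩⟩⟩⟩) hp <;> simp at hp
  simp only [SimpleGraph.Walk.isPath_def, SimpleGraph.Walk.support_cons,
    SimpleGraph.Walk.support_nil, List.nodup_cons, List.mem_cons, List.not_mem_nil, or_false,
    not_or, not_false_eq_true, List.nodup_nil, and_true]
  refine ⟨⟨h₁.ne, ?_, huv⟩, ⟨h₂.ne, ?_⟩, h₃.ne⟩
  · rintro rfl; exact h h₃
  · rintro rfl; exact h h₁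

theorem sum_sq_apply (a : V) :
    ∑ b, (H.adjMatrix ℝ ^ 2) a b = ∑ b, H.adjMatrix ℝ a b * H.degree b := by
  simp only [pow_two, Matrix.mul_apply]
  rw [Finset.sum_comm]
  simp only [← Finset.mul_sum, sum_adjMatrix_row]

theorem quadratic_row_add_single (x y : V) :
    ∑ a, ∑ b, (H.adjMatrix ℝ x a + if a = y then 1 else 0) *
      (H.adjMatrix ℝ x b + if b = y then 1 else 0) * H.adjMatrix ℝ a b =
      (H.adjMatrix ℝ ^ 3) x x + 2 * (H.adjMatrix ℝ ^ 2) x y := by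
  have hs : ∀ a b, H.adjMatrix ℝ a b = H.adjMatrix ℝ b a := fun a b => H.isSymm_adjMatrix.apply b a
  have e1 : (H.adjMatrix ℝ ^ 3) x x =
      ∑ a, ∑ b, H.adjMatrix ℝ x a * H.adjMatrix ℝ x b * H.adjMatrix ℝ a b := by
    rw [pow_succ', pow_two, Matrix.mul_apply]
    refine Finset.sum_congr rfl fun a _ => ?_
    rw [Matrix.mul_apply, Finset.mul_sum]
    refine Finset.sum_congr rfl fun b _ => ?_
    rw [hs b x]; ring
  have e2 : (H.adjMatrix ℝ ^ 2) x y = ∑ a, H.adjMatrix ℝ x a * H.adjMatrix ℝ a y := by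
    rw [pow_two, Matrix.mul_apply]
  have e3 : ∑ a, H.adjMatrix ℝ x a * H.adjMatrix ℝ y a = (H.adjMatrix ℝ ^ 2) x y := by
    rw [e2]; exact Finset.sum_congr rfl fun a _ => by rw [hs y a]
  simp only [add_mul, mul_add, Finset.sum_add_distrib, ← e1]
  simp only [mul_ite, mul_one, mul_zero, ite_mul, one_mul, zero_mul, Finset.sum_ite_eq',
    Finset.mem_univ, if_true, Finset.sum_ite_irrel, Finset.sum_const_zero, ← e2, e3]
  simp
  ring

theorem row_sum_sq_le (x : V) :
    ∑ b, (H.adjMatrix ℝ ^ 2) x b ≤ H.edgeFinset.card + (H.adjMatrix ℝ ^ 3) x x / 2 := by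
  rw [sum_sq_apply]
  refine (sum_mul_degree_le H (fun a => H.adjMatrix ℝ x a) (adjMatrix_le_one H x)).trans
    (le_of_eq ?_)
  congr 2
  rw [pow_succ', pow_two, Matrix.mul_apply]
  refine Finset.sum_congr rfl fun a _ => ?_
  rw [Matrix.mul_apply, Finset.mul_sum]
  refine Finset.sum_congr rfl fun b _ => ?_
  rw [← H.isSymm_adjMatrix.apply x b]; ring

/-- Here the weight is the row of `x` plus the indicator of `y`; nonadjacency keeps it at most one.
-/
theorem row_sum_sq_add_degree_le {x y : V} (h : ¬ H.Adj x y) :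
    ∑ b, (H.adjMatrix ℝ ^ 2) x b + H.degree y ≤
      H.edgeFinset.card + (H.adjMatrix ℝ ^ 3) x x / 2 + (H.adjMatrix ℝ ^ 2) x y := by
  have key := sum_mul_degree_le H (fun a => H.adjMatrix ℝ x a + if a = y then 1 else 0) (by
    intro a
    by_cases ha : a = y
    · subst ha; simp [SimpleGraph.adjMatrix_apply, h]
    · simpa [ha] using adjMatrix_le_one H x a)
  rw [quadratic_row_add_single] at key
  simp only [add_mul, Finset.sum_add_distrib, ← sum_sq_apply] at key
  simp at key
  linarith

/-- Off the diagonal the square has entries 0 or 1, so squaring them changes nothing. All entries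
together sum to `∑ d²`, and the diagonal corrects this by `∑ (d² - d)`. -/
theorem trace_fourth_of_isAcyclic {H : SimpleGraph V} [DecidableRel H.Adj] (hH : H.IsAcyclic) :
    (H.adjMatrix ℝ ^ 4).trace = 2 * ∑ a, (H.degree a : ℝ) ^ 2 - 2 * H.edgeFinset.card := by
  have hd : ∀ a, (H.adjMatrix ℝ ^ 2) a a = H.degree a := fun a => by
    rw [pow_two, SimpleGraph.adjMatrix_mul_self_apply_self]
  have h01 : ∀ a b, a ≠ b → (H.adjMatrix ℝ ^ 2) a b ^ 2 = (H.adjMatrix ℝ ^ 2) a b := by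
    intro a b hab
    rcases sq_apply_eq_zero_or_one hH hab with h | h <;> simp [h]
  have hrow : ∀ a, ∑ b, (H.adjMatrix ℝ ^ 2) a b ^ 2 =
      ∑ b, (H.adjMatrix ℝ ^ 2) a b + ((H.degree a : ℝ) ^ 2 - H.degree a) := by
    intro a
    rw [← Finset.add_sum_erase _ _ (Finset.mem_univ a),
      ← Finset.add_sum_erase _ (fun b => (H.adjMatrix ℝ ^ 2) a b) (Finset.mem_univ a), hd,
      Finset.sum_congr rfl fun b hb => h01 a b (Finset.ne_of_mem_erase hb).symm]
    ring
  have hcol : ∑ a, ∑ b, (H.adjMatrix ℝ ^ 2) a b = ∑ a, (H.degree a : ℝ) ^ 2 := by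
    simp only [sum_sq_apply]
    rw [Finset.sum_comm]
    refine Finset.sum_congr rfl fun b _ => ?_
    rw [← Finset.sum_mul, pow_two, ← sum_adjMatrix_row]
    simp only [H.isSymm_adjMatrix.apply]
  rw [trace_fourth_eq]
  simp only [← pow_two (H.adjMatrix ℝ)]
  simp only [hrow, Finset.sum_add_distrib, Finset.sum_sub_distrib, hcol, sum_degree_real]
  ring

/-- Conjugation by the diagonal matrix of signs negates the adjacency matrix. Hence the parity of a
walk is determined by its endpoints. -/
theorem pow_apply_mul_sign {H : SimpleGraph V} [DecidableRel H.Adj] {s : V → ℝ}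
    (h1 : ∀ a, s a = 1 ∨ s a = -1) (hs : ∀ a b, H.Adj a b → s a * s b = -1) (k : ℕ) (a b : V) :
    (H.adjMatrix ℝ ^ k) a b * (s a * s b) = (-1) ^ k * (H.adjMatrix ℝ ^ k) a b := by
  have hsq : ∀ a, s a * s a = 1 := fun a => by rcases h1 a with h | h <;> simp [h]
  have hT : ∀ a b, H.adjMatrix ℝ a b * (s a * s b) = - H.adjMatrix ℝ a b := by
    intro a b
    rw [SimpleGraph.adjMatrix_apply]
    split_ifs with h
    · rw [hs a b h]; ring
    · simp
  induction k generalizing a b with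
  | zero =>
    by_cases hab : a = b
    · subst hab; simp [hsq]
    · simp [hab]
  | succ k ih =>
    rw [pow_succ, Matrix.mul_apply, Finset.sum_mul, Finset.mul_sum]
    refine Finset.sum_congr rfl fun c _ => ?_
    calc (H.adjMatrix ℝ ^ k) a c * H.adjMatrix ℝ c b * (s a * s b)
        = ((H.adjMatrix ℝ ^ k) a c * (s a * s c)) * (H.adjMatrix ℝ c b * (s c * s b)) := by
          linear_combination (-(H.adjMatrix ℝ ^ k) a c * H.adjMatrix ℝ c b * (s a * s b)) * hsq c
      _ = _ := by rw [ih, hT]; ring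

end Forest

/-! ### The matrix of a single edge -/

section EdgeMatrix

variable {V : Type*} [Fintype V] [DecidableEq V]

/-- The adjacency matrix of the single edge `xy`. -/
def edgeMatrix (x y : V) : Matrix V V ℝ := Matrix.single x y 1 + Matrix.single y x 1

theorem mul_edgeMatrix_apply (M : Matrix V V ℝ) (x y a b : V) :
    (M * edgeMatrix x y) a b = (if b = y then M a x else 0) + if b = x then M a y else 0 := by
  rw [edgeMatrix, Matrix.mul_add, Matrix.add_apply, Matrix.mul_apply, Matrix.mul_apply]
  simp [Matrix.single_apply, ite_and, eq_comm]

theorem mul_edgeMatrix_mul_apply (M N : Matrix V V ℝ) (x y a b : V) :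
    (M * edgeMatrix x y * N) a b = M a x * N y b + M a y * N x b := by
  rw [Matrix.mul_apply]
  simp [mul_edgeMatrix_apply, add_mul, Finset.sum_add_distrib]

theorem edgeMatrix_sq_mul_self (x y : V) (hxy : x ≠ y) :
    edgeMatrix x y * edgeMatrix x y * edgeMatrix x y = edgeMatrix x y := by
  ext a b
  rw [mul_edgeMatrix_apply, mul_edgeMatrix_apply, mul_edgeMatrix_apply]
  simp only [edgeMatrix, Matrix.add_apply, Matrix.single_apply, hxy, hxy.symm, if_true, if_false]
  grind

theorem trace_mul_edgeMatrix (M : Matrix V V ℝ) (x y : V) :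
    (M * edgeMatrix x y).trace = M y x + M x y := by
  simp [Matrix.trace, mul_edgeMatrix_apply, Finset.sum_add_distrib]

end EdgeMatrix

/-! ### Traces of powers of a sum -/

section Words

variable {V : Type*} [Fintype V]

theorem trace_rotate (a b c d e : Matrix V V ℝ) :
    (a * b * c * d * e).trace = (b * c * d * e * a).trace := by
  rw [Matrix.mul_assoc, Matrix.mul_assoc, Matrix.mul_assoc, Matrix.trace_mul_comm]
  simp only [Matrix.mul_assoc]

variable [DecidableEq V] (T E : Matrix V V ℝ)

/-- Words in `T` and `E` are grouped by cyclic rotation, under which the trace is invariant; `E³ =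
E` then shortens runs of `E`. The same scheme serves the fourth and fifth powers. -/
theorem trace_add_cube (hE : E * E * E = E) :
    ((T + E) ^ 3).trace = (T ^ 3).trace + 3 * (T ^ 2 * E).trace + 3 * (T * (E * E)).trace +
      E.trace := by
  have e : (T + E) ^ 3 = T ^ 3 + (T ^ 2 * E + T * E * T + E * T * T) +
      (T * (E * E) + E * T * E + E * E * T) + E * E * E := by noncomm_ring
  have h1 : (T * E * T).trace = (T ^ 2 * E).trace := by
    rw [Matrix.trace_mul_comm, ← Matrix.mul_assoc, pow_two]
  have h2 : (E * T * T).trace = (T ^ 2 * E).trace := by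
    rw [Matrix.mul_assoc, Matrix.trace_mul_comm, pow_two]
  have h3 : (E * T * E).trace = (T * (E * E)).trace := by
    rw [Matrix.mul_assoc, Matrix.trace_mul_comm, Matrix.mul_assoc]
  have h4 : (E * E * T).trace = (T * (E * E)).trace := Matrix.trace_mul_comm _ _
  rw [e, hE]
  simp only [Matrix.trace_add, h1, h2, h3, h4]
  ring

theorem trace_add_fourth (hE : E * E * E = E) :
    ((T + E) ^ 4).trace = (T ^ 4).trace + 4 * (T ^ 3 * E).trace + 4 * (T ^ 2 * (E * E)).trace +
      2 * (T * E * T * E).trace + 4 * (T * E).trace + (E * E).trace := by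
  have e : (T + E) ^ 4 = T ^ 4 + (T ^ 3 * E + T * T * (E * T) + T * (E * T * T) + E * T ^ 3) +
      (T ^ 2 * (E * E) + T * (E * E * T) + E * E * T ^ 2 + E * (T * T * E)) +
      (T * E * T * E + E * T * E * T) +
      (T * (E * E * E) + E * (T * E * E) + (E * E) * (T * E) + E * E * E * T) + E * E * E * E := by
    noncomm_ring
  have h1 : (T * T * (E * T)).trace = (T ^ 3 * E).trace := by
    rw [Matrix.trace_mul_comm, Matrix.mul_assoc, Matrix.trace_mul_comm]; noncomm_ring
  have h2 : (T * (E * T * T)).trace = (T ^ 3 * E).trace := by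
    rw [Matrix.mul_assoc, ← Matrix.mul_assoc, Matrix.trace_mul_comm]; noncomm_ring
  have h3 : (E * T ^ 3).trace = (T ^ 3 * E).trace := Matrix.trace_mul_comm _ _
  have h4 : (T * (E * E * T)).trace = (T ^ 2 * (E * E)).trace := by
    rw [Matrix.trace_mul_comm, Matrix.mul_assoc, Matrix.trace_mul_comm, pow_two]
  have h5 : (E * E * T ^ 2).trace = (T ^ 2 * (E * E)).trace := Matrix.trace_mul_comm _ _
  have h6 : (E * (T * T * E)).trace = (T ^ 2 * (E * E)).trace := by
    rw [Matrix.trace_mul_comm, Matrix.mul_assoc, pow_two]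
  have h7 : (E * T * E * T).trace = (T * E * T * E).trace := by
    rw [Matrix.trace_mul_comm]; noncomm_ring
  have h8 : (E * (T * E * E)).trace = (T * E).trace := by
    rw [Matrix.trace_mul_comm, Matrix.mul_assoc, Matrix.mul_assoc, ← Matrix.mul_assoc E E, hE]
  have h9 : (E * E * (T * E)).trace = (T * E).trace := by
    rw [Matrix.trace_mul_comm, Matrix.mul_assoc, ← Matrix.mul_assoc E E, hE]
  have h10 : (E * T).trace = (T * E).trace := Matrix.trace_mul_comm _ _
  rw [e, hE]
  simp only [Matrix.trace_add, h1, h2, h3, h4, h5, h6, h7, h8, h9, h10]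
  ring

theorem trace_add_fifth (hE : E * E * E = E) :
    ((T + E) ^ 5).trace = (T ^ 5).trace + 5 * (T ^ 4 * E).trace + 5 * (T ^ 3 * (E * E)).trace +
      5 * (T ^ 2 * E * T * E).trace + 5 * (T ^ 2 * E).trace + 5 * (T * E * T * E * E).trace +
      5 * (T * (E * E)).trace + E.trace := by
  have e : (T + E) ^ 5 = T ^ 5 +
      (T * T * T * T * E + T * T * T * E * T + T * T * E * T * T + T * E * T * T * T +
        E * T * T * T * T) +
      (T * T * T * E * E + T * T * E * E * T + T * E * E * T * T + E * E * T * T * T +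
        E * T * T * T * E) +
      (T * T * E * T * E + T * E * T * E * T + E * T * E * T * T + T * E * T * T * E +
        E * T * T * E * T) +
      (E * E * E * T * T + E * E * T * T * E + E * T * T * E * E + T * T * E * E * E +
        T * E * E * E * T) +
      (E * E * T * E * T + E * T * E * T * E + T * E * T * E * E + E * T * E * E * T +
        T * E * E * T * E) +
      (E * E * E * E * T + E * E * E * T * E + E * E * T * E * E + E * T * E * E * E +
        T * E * E * E * E) + E * E * E * E * E := by
    noncomm_ring
  have r := @trace_rotate V _
  have f1 : T * T * T * T * E = T ^ 4 * E := by noncomm_ring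
  have f2 : T * T * T * E * E = T ^ 3 * (E * E) := by noncomm_ring
  have f3 : T * T * E * T * E = T ^ 2 * E * T * E := by noncomm_ring
  have f4 : T * T * E * E * E = T ^ 2 * E := by
    rw [Matrix.mul_assoc (T * T * E), Matrix.mul_assoc (T * T), ← Matrix.mul_assoc E, hE, pow_two]
  have f5 : T * E * E * E * E = T * (E * E) := by
    rw [Matrix.mul_assoc, Matrix.mul_assoc, Matrix.mul_assoc, ← Matrix.mul_assoc E E,
      ← Matrix.mul_assoc (E * E), hE]
  have f6 : E * E * E * E * E = E := by rw [hE, hE]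
  rw [← f1, ← f2, ← f3, ← f4, ← f5, e, f6]
  simp only [Matrix.trace_add]
  -- Each row runs through the five rotations of one cyclic class of words.
  linarith [r T T T T E, r T T T E T, r T T E T T, r T E T T T, r E T T T T,
    r T T T E E, r T T E E T, r T E E T T, r E E T T T, r E T T T E,
    r T T E T E, r T E T E T, r E T E T T, r T E T T E, r E T T E T,
    r E E E T T, r E E T T E, r E T T E E, r T T E E E, r T E E E T,
    r E E T E T, r E T E T E, r T E T E E, r E T E E T, r T E E T E,
    r E E E E T, r E E E T E, r E E T E E, r E T E E E, r T E E E E]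

end Words

/-! ### A unicyclic graph is a tree plus an edge -/

section Decomposition

variable {V : Type*} [Fintype V] [DecidableEq V]

theorem exists_isTree_add_edge {G : SimpleGraph V} [DecidableRel G.Adj] (hG : IsUnicyclic G) :
    ∃ (H : SimpleGraph V) (x y : V), H.IsTree ∧ x ≠ y ∧ ¬ H.Adj x y ∧
      ∀ a b, G.Adj a b ↔ H.Adj a b ∨ (a = x ∧ b = y) ∨ (a = y ∧ b = x) := by
  classical
  obtain ⟨H, hle, hH⟩ := hG.1.exists_isTree_le
  have hcH := hH.card_edgeFinset
  have hsub : H.edgeFinset ⊆ G.edgeFinset := SimpleGraph.edgeFinset_mono hle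
  have hc : (G.edgeFinset \ H.edgeFinset).card = 1 := by
    rw [Finset.card_sdiff_of_subset hsub, hG.2]; omega
  obtain ⟨e, he⟩ := Finset.card_eq_one.mp hc
  induction e with
  | _ x y =>
    have hmem : ∀ a b, (G.Adj a b ∧ ¬ H.Adj a b) ↔ s(a, b) = s(x, y) := by
      intro a b
      have : s(a, b) ∈ G.edgeFinset \ H.edgeFinset ↔ s(a, b) = s(x, y) := by simp [he]
      simpa using this
    have hxy := (hmem x y).2 rfl
    refine ⟨H, x, y, hH, hxy.1.ne, hxy.2, fun a b => ?_⟩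
    have := hmem a b
    rw [Sym2.eq_iff] at this
    constructor
    · intro h
      by_cases hh : H.Adj a b
      · exact .inl hh
      · exact .inr (this.1 ⟨h, hh⟩)
    · rintro (h | h)
      · exact hle h
      · exact (this.2 h).1

end Decomposition

/-! ### Adjacency matrix after adding an edge -/

section EdgeAddition

variable {V : Type*}

theorem adjMatrix_self (H : SimpleGraph V) [DecidableRel H.Adj] (a : V) : H.adjMatrix ℝ a a = 0 := by simp

variable [DecidableEq V] {x y : V}

theorem edgeMatrix_apply_self (hxy : x ≠ y) (a : V) : edgeMatrix x y a a = 0 := by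
  simp only [edgeMatrix, Matrix.add_apply, Matrix.single_apply]
  grind

theorem edgeMatrix_apply (hxy : x ≠ y) : edgeMatrix x y x y = 1 := by
  simp [edgeMatrix, hxy.symm]

theorem edgeMatrix_apply_symm (hxy : x ≠ y) : edgeMatrix x y y x = 1 := by
  simp [edgeMatrix, hxy]

theorem adjMatrix_eq_add_edgeMatrix {G H : SimpleGraph V} [DecidableRel G.Adj]
    [DecidableRel H.Adj] (hxy : x ≠ y) (h : ¬ H.Adj x y)
    (hG : ∀ a b, G.Adj a b ↔ H.Adj a b ∨ (a = x ∧ b = y) ∨ (a = y ∧ b = x)) :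
    G.adjMatrix ℝ = H.adjMatrix ℝ + edgeMatrix x y := by
  ext a b
  have h' : ¬ H.Adj y x := fun hh => h hh.symm
  simp only [Matrix.add_apply, SimpleGraph.adjMatrix_apply, edgeMatrix, Matrix.single_apply, hG]
  by_cases h1 : x = a ∧ y = b
  · obtain ⟨rfl, rfl⟩ := h1
    simp [h, hxy, hxy.symm]
  · by_cases h2 : y = a ∧ x = b
    · obtain ⟨rfl, rfl⟩ := h2
      simp [h', hxy, hxy.symm]
    · have h1' : ¬ (a = x ∧ b = y) := fun hh => h1 ⟨hh.1.symm, hh.2.symm⟩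
      have h2' : ¬ (a = y ∧ b = x) := fun hh => h2 ⟨hh.1.symm, hh.2.symm⟩
      simp [h1, h2, h1', h2']

end EdgeAddition

/-! ### Moments of unicyclic graphs -/

section Moments

variable {V : Type*} [Fintype V] [DecidableEq V]

variable {H : SimpleGraph V} [DecidableRel H.Adj] {x y : V}

theorem pow_apply_self_eq_zero_of_isBipartite (hH : H.IsBipartite) {k : ℕ} (hk : Odd k) (a : V) :
    (H.adjMatrix ℝ ^ k) a a = 0 := by
  obtain ⟨s, h1, hs⟩ := exists_sign_of_isBipartite hH
  have h := pow_apply_mul_sign h1 hs k a a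
  have hsq : s a * s a = 1 := by rcases h1 a with h | h <;> simp [h]
  rw [hsq, hk.neg_one_pow] at h
  linarith

theorem trace_pow_eq_zero_of_isBipartite (hH : H.IsBipartite) {k : ℕ} (hk : Odd k) :
    (H.adjMatrix ℝ ^ k).trace = 0 :=
  Finset.sum_eq_zero fun a _ => pow_apply_self_eq_zero_of_isBipartite hH hk a

theorem pow_apply_eq_zero_or_of_isBipartite (hH : H.IsBipartite) {k l : ℕ} (hk : Even k)
    (hl : Odd l) (a b : V) : (H.adjMatrix ℝ ^ k) a b = 0 ∨ (H.adjMatrix ℝ ^ l) a b = 0 := by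
  obtain ⟨s, h1, hs⟩ := exists_sign_of_isBipartite hH
  have h := pow_apply_mul_sign h1 hs k a b
  have h' := pow_apply_mul_sign h1 hs l a b
  rw [hk.neg_one_pow] at h
  rw [hl.neg_one_pow] at h'
  rcases h1 a with ha | ha <;> rcases h1 b with hb | hb <;> rw [ha, hb] at h h'
  · right; linarith
  · left; linarith
  · left; linarith
  · right; linarith

theorem trace_edgeMatrix (hxy : x ≠ y) : (edgeMatrix x y).trace = 0 :=
  Finset.sum_eq_zero fun a _ => edgeMatrix_apply_self hxy a

theorem trace_cube_add_edgeMatrix (hH : H.IsBipartite) (hxy : x ≠ y) :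
    ((H.adjMatrix ℝ + edgeMatrix x y) ^ 3).trace = 6 * (H.adjMatrix ℝ ^ 2) x y := by
  rw [trace_add_cube _ _ (edgeMatrix_sq_mul_self x y hxy), trace_edgeMatrix hxy,
    trace_pow_eq_zero_of_isBipartite hH (by decide), ← Matrix.mul_assoc, trace_mul_edgeMatrix,
    trace_mul_edgeMatrix, mul_edgeMatrix_apply, mul_edgeMatrix_apply, adjMatrix_pow_symm H 2 y x]
  simp [hxy, hxy.symm]
  ring

theorem trace_fourth_add_edgeMatrix (hxy : x ≠ y) (h : ¬ H.Adj x y) :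
    ((H.adjMatrix ℝ + edgeMatrix x y) ^ 4).trace = (H.adjMatrix ℝ ^ 4).trace +
      8 * (H.adjMatrix ℝ ^ 3) x y + 4 * (H.degree x + H.degree y) + 2 := by
  have h' : ¬ H.Adj y x := fun hh => h hh.symm
  rw [trace_add_fourth _ _ (edgeMatrix_sq_mul_self x y hxy), ← Matrix.mul_assoc,
    trace_mul_edgeMatrix, trace_mul_edgeMatrix, trace_mul_edgeMatrix, trace_mul_edgeMatrix,
    trace_mul_edgeMatrix, mul_edgeMatrix_mul_apply, mul_edgeMatrix_mul_apply,
    mul_edgeMatrix_apply, mul_edgeMatrix_apply, adjMatrix_pow_symm H 3 y x,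
    edgeMatrix_apply hxy, edgeMatrix_apply_symm hxy, pow_two,
    SimpleGraph.adjMatrix_mul_self_apply_self, SimpleGraph.adjMatrix_mul_self_apply_self]
  simp [SimpleGraph.adjMatrix_apply, hxy, hxy.symm, h, h']
  ring

theorem trace_fifth_add_edgeMatrix (hH : H.IsBipartite) (hxy : x ≠ y) (h : ¬ H.Adj x y) :
    ((H.adjMatrix ℝ + edgeMatrix x y) ^ 5).trace =
      10 * ((H.adjMatrix ℝ ^ 4) x y + (H.adjMatrix ℝ ^ 2) x y) := by
  have h' : H.adjMatrix ℝ y x = 0 := by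
    rw [SimpleGraph.adjMatrix_apply, if_neg fun hh => h hh.symm]
  have h'' : H.adjMatrix ℝ x y = 0 := by rw [SimpleGraph.adjMatrix_apply, if_neg h]
  rw [trace_add_fifth _ _ (edgeMatrix_sq_mul_self x y hxy), trace_edgeMatrix hxy,
    trace_pow_eq_zero_of_isBipartite hH (by decide), ← Matrix.mul_assoc (H.adjMatrix ℝ ^ 3),
    ← Matrix.mul_assoc (H.adjMatrix ℝ)]
  simp only [trace_mul_edgeMatrix, mul_edgeMatrix_mul_apply, mul_edgeMatrix_apply,
    adjMatrix_pow_symm H 4 y x, adjMatrix_pow_symm H 2 y x,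
    pow_apply_self_eq_zero_of_isBipartite hH (show Odd 3 by decide), h', h'', adjMatrix_self]
  simp [hxy, hxy.symm]
  ring

/-- Every triangle uses the new edge, so the triangles correspond to the common neighbours of `x`
and `y`; each triangle through `v` gives two closed walks. -/
theorem cube_apply_self_add_edgeMatrix_le (hH : H.IsBipartite) (hxy : x ≠ y) (h : ¬ H.Adj x y)
    (v : V) : ((H.adjMatrix ℝ + edgeMatrix x y) ^ 3) v v ≤ 2 * (H.adjMatrix ℝ ^ 2) x y := by
  have e : (H.adjMatrix ℝ + edgeMatrix x y) ^ 3 = H.adjMatrix ℝ ^ 3 +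
      (H.adjMatrix ℝ ^ 2 * edgeMatrix x y + H.adjMatrix ℝ * edgeMatrix x y * H.adjMatrix ℝ +
        1 * edgeMatrix x y * H.adjMatrix ℝ ^ 2) +
      (H.adjMatrix ℝ * edgeMatrix x y * edgeMatrix x y +
        1 * edgeMatrix x y * H.adjMatrix ℝ * edgeMatrix x y +
        1 * edgeMatrix x y * (edgeMatrix x y * H.adjMatrix ℝ)) +
      edgeMatrix x y * edgeMatrix x y * edgeMatrix x y := by noncomm_ring
  have hs : ∀ a b, H.adjMatrix ℝ a b = H.adjMatrix ℝ b a := fun a b => H.isSymm_adjMatrix.apply b a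
  have hE : ∀ a b, (edgeMatrix x y * H.adjMatrix ℝ) a b =
      (1 : Matrix V V ℝ) a x * H.adjMatrix ℝ y b + (1 : Matrix V V ℝ) a y * H.adjMatrix ℝ x b := by
    intro a b
    rw [← mul_edgeMatrix_mul_apply, Matrix.one_mul]
  rw [e, edgeMatrix_sq_mul_self x y hxy]
  simp only [Matrix.add_apply, mul_edgeMatrix_mul_apply, mul_edgeMatrix_apply, hE,
    edgeMatrix_apply_self hxy, pow_apply_self_eq_zero_of_isBipartite hH (show Odd 3 by decide)]
  have h'' : H.adjMatrix ℝ x y = 0 := by rw [SimpleGraph.adjMatrix_apply, if_neg h]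
  have hn := adjMatrix_pow_nonneg H 2 x y
  by_cases h1 : v = x
  · subst h1
    simp only [h'', hs y v, adjMatrix_self, adjMatrix_pow_symm H 2 y v, Matrix.one_apply, hxy,
      hxy.symm, if_true, if_false]
    linarith
  by_cases h2 : v = y
  · subst h2
    simp only [h'', hs v x, adjMatrix_self, adjMatrix_pow_symm H 2 v x, Matrix.one_apply, hxy,
      hxy.symm, if_true, if_false]
    linarith
  have hle : H.adjMatrix ℝ x v * H.adjMatrix ℝ v y ≤ (H.adjMatrix ℝ ^ 2) x y := by
    rw [pow_two, Matrix.mul_apply]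
    exact Finset.single_le_sum (f := fun a => H.adjMatrix ℝ x a * H.adjMatrix ℝ a y)
      (fun a _ => mul_nonneg (adjMatrix_nonneg H _ _) (adjMatrix_nonneg H _ _)) (Finset.mem_univ v)
  simp only [Matrix.one_apply, h1, h2, if_false, hs y v, hs v x] at hle ⊢
  linarith

/-- Split a walk at its midpoint `u`. The second half contributes at most 1 unless `u = y`, where it
contributes `deg y`; that excess occurs only if `x` and `y` have a common neighbour, and then the
row bound including `deg y` absorbs it. -/
theorem fourth_apply_le_of_isTree (hH : H.IsTree) (hxy : x ≠ y) (h : ¬ H.Adj x y) :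
    (H.adjMatrix ℝ ^ 4) x y ≤ H.edgeFinset.card := by
  have hb := hH.isBipartite
  have h3 := pow_apply_self_eq_zero_of_isBipartite hb (show Odd 3 by decide) x
  have r1 := row_sum_sq_le H x
  have r2 := row_sum_sq_add_degree_le H h
  rw [h3] at r1 r2
  have hle : (H.adjMatrix ℝ ^ 4) x y ≤
      ∑ u, (H.adjMatrix ℝ ^ 2) x u + (H.degree y - 1) * (H.adjMatrix ℝ ^ 2) x y := by
    rw [show 4 = 2 + 2 from rfl, pow_add, Matrix.mul_apply,
      ← Finset.add_sum_erase _ _ (Finset.mem_univ y),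
      ← Finset.add_sum_erase _ (fun b => (H.adjMatrix ℝ ^ 2) x b) (Finset.mem_univ y)]
    have hd : (H.adjMatrix ℝ ^ 2) y y = H.degree y := by
      rw [pow_two, SimpleGraph.adjMatrix_mul_self_apply_self]
    have : ∑ u ∈ Finset.univ.erase y, (H.adjMatrix ℝ ^ 2) x u * (H.adjMatrix ℝ ^ 2) u y ≤
        ∑ u ∈ Finset.univ.erase y, (H.adjMatrix ℝ ^ 2) x u :=
      Finset.sum_le_sum fun u hu => mul_le_of_le_one_right (adjMatrix_pow_nonneg H 2 x u)
        (sq_apply_le_one hH.isAcyclic (Finset.ne_of_mem_erase hu))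
    rw [hd]
    linarith
  rcases sq_apply_eq_zero_or_one hH.isAcyclic hxy with hc | hc <;> rw [hc] at hle r2 <;> linarith

/-- The number `c` counts triangles. The term `8 * (1 - c)` allows for the eight closed walks around
a four-cycle, which cannot coexist with a triangle. -/
theorem IsUnicyclic.moment_bounds {G : SimpleGraph V} [DecidableRel G.Adj] (hG : IsUnicyclic G)
    {n : ℝ} (hn : (Fintype.card V : ℝ) = n) :
    ∃ c : ℝ, (c = 0 ∨ c = 1) ∧ (G.adjMatrix ℝ ^ 3).trace = 6 * c ∧
      (G.adjMatrix ℝ ^ 4).trace ≤ 2 * ∑ a, (G.degree a : ℝ) ^ 2 - 2 * n + 8 * (1 - c) ∧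
      (G.adjMatrix ℝ ^ 5).trace ≤ 10 * n ∧
      ∀ a, ∑ b, (G.adjMatrix ℝ * G.adjMatrix ℝ) a b ≤ n + c := by
  classical
  obtain ⟨H, x, y, hH, hxy, h, hadj⟩ := exists_isTree_add_edge hG
  have hA := adjMatrix_eq_add_edgeMatrix hxy h hadj
  have hb := hH.isBipartite
  have hcard : (H.edgeFinset.card : ℝ) + 1 = n := by
    rw [← hn]; exact_mod_cast hH.card_edgeFinset
  have hc := sq_apply_eq_zero_or_one hH.isAcyclic hxy
  have hdeg : ∀ a, (G.degree a : ℝ) =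
      H.degree a + ((if a = x then 1 else 0) + if a = y then 1 else 0) := by
    intro a
    rw [← sum_adjMatrix_row, ← sum_adjMatrix_row, hA]
    simp only [Matrix.add_apply, Finset.sum_add_distrib, edgeMatrix, Matrix.single_apply, ite_and]
    simp [eq_comm]
  have hdsq : ∑ a, (G.degree a : ℝ) ^ 2 =
      ∑ a, (H.degree a : ℝ) ^ 2 + 2 * (H.degree x + H.degree y) + 2 := by
    have : ∀ a, (G.degree a : ℝ) ^ 2 = (H.degree a : ℝ) ^ 2 +
        ((if a = x then 2 * (H.degree a : ℝ) + 1 else 0) +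
          if a = y then 2 * (H.degree a : ℝ) + 1 else 0) := by
      intro a
      rw [hdeg]
      by_cases h1 : a = x
      · subst h1; simp [hxy]; ring
      · by_cases h2 : a = y
        · subst h2; simp [hxy.symm]; ring
        · simp [h1, h2]
    simp only [this, Finset.sum_add_distrib, Finset.sum_ite_eq', Finset.mem_univ, if_true]
    ring
  refine ⟨(H.adjMatrix ℝ ^ 2) x y, hc, ?_, ?_, ?_, fun a => ?_⟩
  · rw [hA, trace_cube_add_edgeMatrix hb hxy]
  -- By parity, walks of length two and of length three from `x` to `y` exclude each other.
  · have h3 : (H.adjMatrix ℝ ^ 3) x y ≤ 1 - (H.adjMatrix ℝ ^ 2) x y := by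
      rcases pow_apply_eq_zero_or_of_isBipartite hb (show Even 2 by decide)
        (show Odd 3 by decide) x y with h0 | h0
      · rw [h0, sub_zero]; exact cube_apply_le_one hH.isAcyclic hxy h
      · rw [h0]; linarith [sq_apply_le_one hH.isAcyclic hxy]
    rw [hA, trace_fourth_add_edgeMatrix hxy h, trace_fourth_of_isAcyclic hH.isAcyclic, hdsq]
    linarith
  · have h4 := fourth_apply_le_of_isTree hH hxy h
    have h2 := sq_apply_le_one hH.isAcyclic hxy
    rw [hA, trace_fifth_add_edgeMatrix hb hxy h]
    linarith
  · have h1 := row_sum_sq_le G a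
    have h2 := cube_apply_self_add_edgeMatrix_le hb hxy h a
    rw [← hA] at h2
    rw [hG.2, hn] at h1
    simp only [← pow_two]
    linarith

end Moments

/-! ### Sums of squares under constraints, and degree sums -/

section Degrees

open Finset

theorem not_triangle_of_isBipartite {V : Type*} {G : SimpleGraph V}
    (hG : G.IsBipartite) {a b c : V} (hab : G.Adj a b) (hac : G.Adj a c) : ¬ G.Adj b c := by
  intro hbc
  obtain ⟨C⟩ := hG
  have h1 := C.valid hab
  have h2 := C.valid hac
  have h3 := C.valid hbc
  omega

/-- By convexity the extreme profile is `(k, 1)`: merging all entries but one positive entry into a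
single one does not lower the sum of squares. -/
theorem sum_sq_le_of_lt_sum {V : Type*} [DecidableEq V] {s : Finset V} {x : V → ℕ} {k : ℕ}
    (hs : ∑ u ∈ s, x u = k + 1) (hx : ∀ u ∈ s, x u ≤ k) : ∑ u ∈ s, x u ^ 2 ≤ k ^ 2 + 1 := by
  obtain ⟨u, hu, hpos⟩ : ∃ u ∈ s, 0 < x u := by
    by_contra! h
    have : ∑ u ∈ s, x u = 0 := sum_eq_zero fun u hu => Nat.le_zero.mp (h u hu)
    omega
  have hle := hx u hu
  rw [← add_sum_erase s _ hu] at hs ⊢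
  have h1 : ∑ v ∈ s.erase u, x v ^ 2 ≤ (∑ v ∈ s.erase u, x v) ^ 2 :=
    sum_sq_le_sq_sum_of_nonneg fun _ _ => Nat.zero_le _
  generalize ∑ v ∈ s.erase u, x v = r at hs h1
  obtain ⟨b, hb⟩ : ∃ b, x u = b + 1 := ⟨x u - 1, by omega⟩
  obtain ⟨c, rfl⟩ : ∃ c, r = c + 1 := ⟨r - 1, by omega⟩
  obtain rfl : k = b + c + 1 := by omega
  rw [hb]
  nlinarith [Nat.zero_le (b * c)]

/-- Extreme profile `(k, 1, 1)`. Once one positive entry is removed, the pair condition is the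
entrywise hypothesis of `sum_sq_le_of_lt_sum`. -/
theorem sum_sq_le_of_pair_lt_sum {V : Type*} [DecidableEq V] {s : Finset V} {x : V → ℕ} {k : ℕ}
    (hs : ∑ u ∈ s, x u = k + 2) (hx : ∀ u ∈ s, x u ≤ k + 1)
    (hxx : ∀ u ∈ s, ∀ v ∈ s, u ≠ v → x u + x v ≤ k + 1) : ∑ u ∈ s, x u ^ 2 ≤ k ^ 2 + 2 := by
  obtain ⟨u, hu, hpos⟩ : ∃ u ∈ s, 0 < x u := by
    by_contra! h
    have : ∑ u ∈ s, x u = 0 := sum_eq_zero fun u hu => Nat.le_zero.mp (h u hu)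
    omega
  have hle := hx u hu
  rw [← add_sum_erase s _ hu] at hs ⊢
  have hrest : ∀ v ∈ s.erase u, x v ≤ k + 1 - x u := fun v hv => by
    have := hxx u hu v (mem_of_mem_erase hv) (ne_of_mem_erase hv).symm
    omega
  have hlt : x u ≤ k := by
    by_contra! h
    have : ∑ v ∈ s.erase u, x v = 0 := sum_eq_zero fun v hv => by
      have := hrest v hv
      omega
    omega
  have h1 := sum_sq_le_of_lt_sum (s := s.erase u) (x := x) (k := k + 1 - x u) (by omega) hrest
  obtain ⟨b, hb⟩ : ∃ b, x u = b + 1 := ⟨x u - 1, by omega⟩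
  obtain ⟨c, rfl⟩ : ∃ c, k = b + 1 + c := ⟨k - (b + 1), by omega⟩
  have hk : b + 1 + c + 1 - x u = c + 1 := by omega
  rw [hk] at h1
  rw [hb]
  nlinarith [Nat.zero_le (b * c)]

variable {V : Type*} [Fintype V]

theorem sum_sq_eq_of_le_one {x : V → ℕ} (h : ∀ v, x v ≤ 1) : ∑ u, x u ^ 2 = ∑ u, x u :=
  sum_congr rfl fun u _ => by
    have := h u
    interval_cases x u <;> rfl

variable [DecidableEq V]

/-- Extreme profile `(k, 2, 1)`, used with `k = n - 3` and entries `d - 1`. Removing an entry at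
least 2 reduces to `sum_sq_le_of_lt_sum`. -/
theorem sum_sq_le_of_le_sub_three {x : V → ℕ} {k : ℕ} (hs : ∑ u, x u = k + 3)
    (hx : ∀ u, x u ≤ k) (hxx : ∀ u v, u ≠ v → x u + x v ≤ k + 2) :
    ∑ u, x u ^ 2 ≤ k ^ 2 + 5 := by
  by_cases h : ∃ v, 2 ≤ x v
  · obtain ⟨v, hv⟩ := h
    have hle := hx v
    rw [← add_sum_erase _ _ (mem_univ v)] at hs ⊢
    have h1 := sum_sq_le_of_lt_sum (s := univ.erase v) (x := x) (k := k + 2 - x v) (by omega)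
      fun u hu => by
        have := hxx v u (ne_of_mem_erase hu).symm
        omega
    obtain ⟨b, hb⟩ : ∃ b, x v = b + 2 := ⟨x v - 2, by omega⟩
    obtain ⟨c, rfl⟩ : ∃ c, k = b + 2 + c := ⟨k - (b + 2), by omega⟩
    have hk : b + 2 + c + 2 - x v = c + 2 := by omega
    rw [hk] at h1
    rw [hb]
    nlinarith [Nat.zero_le (b * c)]
  · push Not at h
    rw [sum_sq_eq_of_le_one fun v => Nat.le_of_lt_succ (h v), hs]
    rcases Nat.lt_or_ge k 2 with hk | hk
    · interval_cases k <;> simp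
    · nlinarith

/-- Extreme profile `(k, 2, 1, 1)`, used with `k = n - 4`; the triple condition becomes the pair
condition after one removal. -/
theorem sum_sq_le_of_le_sub_four {x : V → ℕ} {k : ℕ} (hs : ∑ u, x u = k + 4)
    (hx : ∀ u, x u ≤ k) (hxx : ∀ u v, u ≠ v → x u + x v ≤ k + 3)
    (hxxx : ∀ u v w, u ≠ v → u ≠ w → v ≠ w → x u + x v + x w ≤ k + 3) :
    ∑ u, x u ^ 2 ≤ k ^ 2 + 6 := by
  by_cases h : ∃ v, 2 ≤ x v
  · obtain ⟨v, hv⟩ := h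
    have hle := hx v
    rw [← add_sum_erase _ _ (mem_univ v)] at hs ⊢
    have h1 := sum_sq_le_of_pair_lt_sum (s := univ.erase v) (x := x) (k := k + 2 - x v) (by omega)
      (fun u hu => by
        have := hxx v u (ne_of_mem_erase hu).symm
        omega)
      (fun u hu w hw huw => by
        have := hxxx v u w (ne_of_mem_erase hu).symm (ne_of_mem_erase hw).symm huw
        omega)
    obtain ⟨b, hb⟩ : ∃ b, x v = b + 2 := ⟨x v - 2, by omega⟩
    obtain ⟨c, rfl⟩ : ∃ c, k = b + 2 + c := ⟨k - (b + 2), by omega⟩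
    have hk : b + 2 + c + 2 - x v = c + 2 := by omega
    rw [hk] at h1
    rw [hb]
    nlinarith [Nat.zero_le (b * c)]
  · push Not at h
    rw [sum_sq_eq_of_le_one fun v => Nat.le_of_lt_succ (h v), hs]
    rcases Nat.lt_or_ge k 2 with hk | hk
    · interval_cases k <;> simp
    · nlinarith

variable {G : SimpleGraph V} [DecidableRel G.Adj]

theorem sum_degree_finset_le (I : Finset V) :
    ∑ a ∈ I, (G.degree a : ℝ) ≤
      G.edgeFinset.card + (∑ a ∈ I, ∑ b ∈ I, G.adjMatrix ℝ a b) / 2 := by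
  have h := sum_mul_degree_le G (fun a => if a ∈ I then 1 else 0) (by
    intro a; split_ifs <;> norm_num)
  simpa only [boole_mul, ite_mul, zero_mul, one_mul, sum_ite_irrel, sum_ite_mem, univ_inter,
    sum_const_zero] using h

theorem degree_add_degree_le {u v : V} (huv : u ≠ v) :
    (G.degree u + G.degree v : ℝ) ≤ G.edgeFinset.card + G.adjMatrix ℝ u v := by
  have h := sum_degree_finset_le (G := G) {u, v}
  simp only [sum_pair huv, adjMatrix_self] at h
  rw [G.isSymm_adjMatrix.apply u v] at h
  linarith

theorem degree_add_degree_add_degree_le (hG : G.IsBipartite) {u v w : V} (huv : u ≠ v)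
    (huw : u ≠ w) (hvw : v ≠ w) :
    (G.degree u + G.degree v + G.degree w : ℝ) ≤ G.edgeFinset.card + 2 := by
  have h := sum_degree_finset_le (G := G) {u, v, w}
  have hu : u ∉ ({v, w} : Finset V) := by simp [huv, huw]
  simp only [sum_insert hu, sum_pair hvw, adjMatrix_self] at h
  rw [G.isSymm_adjMatrix.apply u v, G.isSymm_adjMatrix.apply u w,
    G.isSymm_adjMatrix.apply v w] at h
  -- A bipartite graph has no triangle, so at most two of the three pairs are adjacent.
  have h3 : G.adjMatrix ℝ u v + G.adjMatrix ℝ u w + G.adjMatrix ℝ v w ≤ 2 := by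
    have := fun h h' => not_triangle_of_isBipartite hG (a := u) (b := v) (c := w) h h'
    simp only [SimpleGraph.adjMatrix_apply]
    split_ifs <;> first | exact absurd ‹_› (this ‹_› ‹_›) | norm_num
  linarith

end Degrees

/-! ### Rational inequalities in the order -/

section Polynomial

theorem energy_bound_triangle {n : ℝ} (hn : 5 ≤ n) :
    1 + 2 * n / n ^ 3 + 6 / n ^ 4 +
        (n * (2 * n ^ 2 - 8 * n + 28) + 10 * n) / (n ^ 4 * (n ^ 2 - (n + 1))) <
      1 + (2 * n ^ 3 + 2 * n + 12) / (n * (n ^ 4 - n ^ 3 - n - 3)) := by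
  -- After this shift the denominators and the cleared difference have no negative coefficients in
  -- `m`, so `positivity` applies.
  obtain ⟨m, hm, rfl⟩ : ∃ m : ℝ, 0 ≤ m ∧ n = m + 5 := ⟨n - 5, by linarith, by ring⟩
  have e1 : (m + 5) ^ 2 - (m + 5 + 1) = m ^ 2 + 9 * m + 19 := by ring
  have e2 : (m + 5) ^ 4 - (m + 5) ^ 3 - (m + 5) - 3 =
    m ^ 4 + 19 * m ^ 3 + 135 * m ^ 2 + 424 * m + 492 := by ring
  rw [e1, e2, ← sub_pos]
  field_simp
  ring_nf
  positivity

theorem energy_bound_triangleFree {n : ℝ} (hn : 4 ≤ n) :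
    1 + 2 * n / n ^ 3 + (n * (2 * n ^ 2 - 8 * n + 36) + 10 * n) / (n ^ 4 * (n ^ 2 - n)) <
      1 + (2 * n ^ 3 + 2 * n + 12) / (n * (n ^ 4 - n ^ 3 - n - 3)) := by
  obtain ⟨m, hm, rfl⟩ : ∃ m : ℝ, 0 ≤ m ∧ n = m + 4 := ⟨n - 4, by linarith, by ring⟩
  have e1 : (m + 4) ^ 2 - (m + 4) = (m + 4) * (m + 3) := by ring
  have e2 : (m + 4) ^ 4 - (m + 4) ^ 3 - (m + 4) - 3 =
    m ^ 4 + 15 * m ^ 3 + 84 * m ^ 2 + 207 * m + 185 := by ring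
  rw [e1, e2, ← sub_pos]
  field_simp
  ring_nf
  positivity

theorem energy_bound_bipartite {n : ℝ} (hn : 6 ≤ n) :
    1 + 2 * n / n ^ 3 + n * (2 * n ^ 2 - 12 * n + 52) / (n ^ 4 * (n ^ 2 - n)) <
      1 + (2 * n ^ 3 - 8 * n + 32) / (n * (n ^ 4 - n ^ 3 + 2 * n - 8)) := by
  obtain ⟨m, hm, rfl⟩ : ∃ m : ℝ, 0 ≤ m ∧ n = m + 6 := ⟨n - 6, by linarith, by ring⟩
  have e1 : (m + 6) ^ 2 - (m + 6) = (m + 6) * (m + 5) := by ring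
  have e2 : (m + 6) ^ 4 - (m + 6) ^ 3 + 2 * (m + 6) - 8 =
    m ^ 4 + 23 * m ^ 3 + 198 * m ^ 2 + 758 * m + 1084 := by ring
  rw [e1, e2, ← sub_pos]
  field_simp
  ring_nf
  positivity

end Polynomial

/-! ### Recognising the extremal graphs -/

section Characterization

variable {V : Type*} [Fintype V] [DecidableEq V] {G : SimpleGraph V}

theorem nonempty_iso_cycleWithPendents {k m : ℕ} (f : Fin k → V) (hf : Function.Injective f)
    (hcard : Fintype.card V = k + m)
    (h1 : ∀ i j, G.Adj (f i) (f j) ↔ (SimpleGraph.cycleGraph k).Adj i j)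
    (h2 : ∀ i, ∀ p ∉ Set.range f, G.Adj (f i) p ↔ i.val = 0)
    (h3 : ∀ p ∉ Set.range f, ∀ q ∉ Set.range f, ¬ G.Adj p q) :
    Nonempty (G ≃g cycleWithPendents k m) := by
  classical
  have hc : Fintype.card ((Set.range f)ᶜ : Set V) = m := by
    rw [Fintype.card_compl_set, Set.card_range_of_injective hf, hcard, Fintype.card_fin]
    omega
  let e : Fin k ⊕ Fin m ≃ V :=
    (Equiv.sumCongr (Equiv.ofInjective f hf) (Fintype.equivFinOfCardEq hc).symm).trans
      (Equiv.Set.sumCompl (Set.range f))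
  have el : ∀ i, e (.inl i) = f i := fun i => rfl
  have er : ∀ p, e (.inr p) ∉ Set.range f := fun p =>
    ((Fintype.equivFinOfCardEq hc).symm p).2
  refine ⟨(RelIso.symm ⟨e, ?_⟩ : G ≃g cycleWithPendents k m)⟩
  rintro (i | p) (j | q)
  · rw [el, el, h1]; rfl
  · rw [el, h2 i _ (er q)]; rfl
  · rw [el, G.adj_comm, h2 j _ (er p)]; rfl
  · exact iff_of_false (h3 _ (er p) _ (er q)) id

variable [DecidableRel G.Adj]

theorem IsUnicyclic.degree_pos (hG : IsUnicyclic G) (hV : 4 ≤ Fintype.card V) (v : V) :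
    0 < G.degree v := by
  have : Nontrivial V := Fintype.one_lt_card_iff_nontrivial.mp (by omega)
  exact hG.1.preconnected.degree_pos_of_nontrivial v

theorem IsUnicyclic.sum_degree_sub_one (hG : IsUnicyclic G) (hV : 4 ≤ Fintype.card V) :
    ∑ v, (G.degree v - 1) = Fintype.card V := by
  have h := G.sum_degrees_eq_twice_card_edges
  rw [hG.2] at h
  have : ∑ v, (G.degree v - 1) + ∑ _v : V, 1 = ∑ v, G.degree v := by
    rw [← Finset.sum_add_distrib]
    exact Finset.sum_congr rfl fun v _ => Nat.sub_add_cancel (hG.degree_pos hV v)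
  simp only [Finset.sum_const, Finset.card_univ, smul_eq_mul, mul_one] at this
  omega

theorem adj_of_degree_eq_card_sub_one {v : V} (hv : G.degree v = Fintype.card V - 1) {u : V}
    (hu : u ≠ v) : G.Adj v u := by
  have hs : G.neighborFinset v ⊆ Finset.univ.erase v := fun w hw => by
    simp only [SimpleGraph.mem_neighborFinset] at hw
    simp [hw.ne']
  have := Finset.eq_of_subset_of_card_le hs (by
    rw [Finset.card_erase_of_mem (Finset.mem_univ v), Finset.card_univ,
      SimpleGraph.card_neighborFinset_eq_degree, hv])
  rw [← SimpleGraph.mem_neighborFinset, this]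
  simp [hu]

/-- The excesses sum to `n` and `v` takes `n - 2`. A vertex `y` of degree at least 2 has a neighbour
`z ≠ v`, also of degree at least 2; these use up the remaining two units, so all other vertices are
pendent at `v`. -/
theorem IsUnicyclic.nonempty_iso_X (hG : IsUnicyclic G) {n : ℕ} (hn : 4 ≤ n)
    (hV : Fintype.card V = n) {v : V} (hv : G.degree v = n - 1) : Nonempty (G ≃g X n) := by
  have hadj : ∀ {u}, u ≠ v → G.Adj v u := fun hu => adj_of_degree_eq_card_sub_one (by omega) hu
  have hsum := hG.sum_degree_sub_one (by omega)
  rw [hV] at hsum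
  obtain ⟨y, hyv, hy⟩ : ∃ y, y ≠ v ∧ 2 ≤ G.degree y := by
    by_contra! h
    have : ∑ u, (G.degree u - 1) = G.degree v - 1 := Finset.sum_eq_single_of_mem v
      (Finset.mem_univ v) fun u _ hu => by have := h u hu; omega
    omega
  obtain ⟨z, hz, hzv⟩ : ∃ z, G.Adj y z ∧ z ≠ v := by
    by_contra! h
    have : G.neighborFinset y ⊆ {v} := fun z hz => by
      simpa using h z ((G.mem_neighborFinset y z).mp hz)
    have := Finset.card_le_card this
    rw [SimpleGraph.card_neighborFinset_eq_degree, Finset.card_singleton] at this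
    omega
  have hpairle : ∀ {a b c}, G.Adj c a → G.Adj c b → a ≠ b → 2 ≤ G.degree c := by
    intro a b c ha hb hab
    rw [← SimpleGraph.card_neighborFinset_eq_degree, ← Finset.card_pair hab]
    refine Finset.card_le_card fun w hw => ?_
    rw [Finset.mem_insert, Finset.mem_singleton] at hw
    rcases hw with rfl | rfl <;> simpa
  have hzd : 2 ≤ G.degree z := hpairle (hadj hzv).symm hz.symm hyv.symm
  have htri : ∀ I : Finset V, ∑ u ∈ I, (G.degree u - 1) ≤ n := fun I => hsum ▸
    Finset.sum_le_sum_of_subset (Finset.subset_univ I)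
  have hvyz : v ∉ ({y, z} : Finset V) := by simp [hyv.symm, hzv.symm]
  have hI := htri {v, y, z}
  rw [Finset.sum_insert hvyz, Finset.sum_pair hz.ne] at hI
  have hy2 : G.degree y = 2 := by omega
  have hz2 : G.degree z = 2 := by omega
  have hu1 : ∀ u, u ≠ v → u ≠ y → u ≠ z → G.degree u ≤ 1 := by
    intro u h1 h2 h3
    have hI := htri (insert u {v, y, z})
    rw [Finset.sum_insert (by simp [h1, h2, h3]), Finset.sum_insert hvyz,
      Finset.sum_pair hz.ne] at hI
    omega
  have hNu : ∀ u, u ≠ v → u ≠ y → u ≠ z → ∀ w, G.Adj u w → w = v := by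
    intro u h1 h2 h3 w hw
    by_contra hwv
    have := hpairle hw (hadj h1).symm hwv
    have := hu1 u h1 h2 h3
    omega
  have hyz : ∀ u, u ≠ v → u ≠ y → u ≠ z → ¬ G.Adj y u ∧ ¬ G.Adj z u := fun u h1 h2 h3 =>
    ⟨fun h => hyv (hNu u h1 h2 h3 y h.symm), fun h => hzv (hNu u h1 h2 h3 z h.symm)⟩
  refine nonempty_iso_cycleWithPendents ![v, y, z] ?_ (by omega) ?_ ?_ ?_
  · intro i j
    fin_cases i <;> fin_cases j <;> simp [hyv, hyv.symm, hzv, hzv.symm, hz.ne, hz.ne']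
  · have hc : ∀ i j : Fin 3, (SimpleGraph.cycleGraph 3).Adj i j ↔ i ≠ j := by decide
    intro i j
    rw [hc]
    fin_cases i <;> fin_cases j <;>
      simp [hadj hyv, hadj hzv, (hadj hyv).symm, (hadj hzv).symm, hz, hz.symm]
  · intro i p hp
    have hp' : p ≠ v ∧ p ≠ y ∧ p ≠ z := ⟨fun h => hp ⟨0, h.symm⟩, fun h => hp ⟨1, h.symm⟩,
      fun h => hp ⟨2, h.symm⟩⟩
    have := hyz p hp'.1 hp'.2.1 hp'.2.2
    fin_cases i <;> simp [hadj hp'.1, this]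
  · intro p hp q hq h
    have hp' : p ≠ v ∧ p ≠ y ∧ p ≠ z := ⟨fun h => hp ⟨0, h.symm⟩, fun h => hp ⟨1, h.symm⟩,
      fun h => hp ⟨2, h.symm⟩⟩
    exact hq ⟨0, (hNu p hp'.1 hp'.2.1 hp'.2.2 q h).symm⟩

theorem IsUnicyclic.degree_ne_of_isBipartite (hG : IsUnicyclic G) (hb : G.IsBipartite)
    (hV : 4 ≤ Fintype.card V) (v : V) : G.degree v ≠ Fintype.card V - 1 := by
  intro hv
  obtain ⟨e⟩ := hG.nonempty_iso_X hV rfl hv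
  have h : ∀ i j : Fin 3, i ≠ j → G.Adj (e.symm (.inl i)) (e.symm (.inl j)) := by
    intro i j hij
    rw [e.symm.map_adj_iff]
    have hc : ∀ i j : Fin 3, i ≠ j → (SimpleGraph.cycleGraph 3).Adj i j := by decide
    exact hc i j hij
  exact not_triangle_of_isBipartite hb (h 0 1 (by decide)) (h 0 2 (by decide))
    (h 1 2 (by decide))

/-- Exactly one vertex `w` is not adjacent to `v`. Having no triangles, the neighbours of `v` can
only be joined to `v` and `w`, so everything reduces to `deg w = 2`. -/
theorem IsUnicyclic.nonempty_iso_XTilde (hG : IsUnicyclic G) (hb : G.IsBipartite) {n : ℕ}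
    (hn : 4 ≤ n) (hV : Fintype.card V = n) {v : V} (hv : G.degree v = n - 2) :
    Nonempty (G ≃g XTilde n) := by
  have hcard : (insert v (G.neighborFinset v))ᶜ.card = 1 := by
    rw [Finset.card_compl, Finset.card_insert_of_notMem (by simp),
      SimpleGraph.card_neighborFinset_eq_degree]
    omega
  obtain ⟨w, hw⟩ := Finset.card_eq_one.mp hcard
  have hmem : ∀ u, (u ≠ v ∧ ¬ G.Adj v u) ↔ u = w := by
    intro u
    rw [← Finset.mem_singleton, ← hw]
    simp
  obtain ⟨hwv, hvw⟩ := (hmem w).2 rfl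
  have hadj : ∀ {u}, u ≠ v → u ≠ w → G.Adj v u := fun {u} h1 h2 => by
    by_contra h
    exact h2 ((hmem u).1 ⟨h1, h⟩)
  have hNu : ∀ u, u ≠ v → u ≠ w → ∀ {a}, G.Adj u a → a = v ∨ a = w := by
    intro u h1 h2 a ha
    by_contra! h
    exact not_triangle_of_isBipartite hb (hadj h1 h2) (hadj h.1 h.2) ha
  have hwle : G.degree w ≤ 2 := by
    have h := degree_add_degree_le (G := G) hwv.symm
    rw [SimpleGraph.adjMatrix_apply, if_neg hvw, hG.2] at h
    have h' : G.degree v + G.degree w ≤ Fintype.card V := by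
      rw [add_zero] at h
      exact_mod_cast h
    omega
  have hwge : 2 ≤ G.degree w := by
    -- The last two terms are corrections at `u = v`, where `n - 2 = 1 + (n - 3)`, and at `u = w`.
    -- Summing gives `2n ≤ 2n - 3 + 2 deg w`.
    have hdeg : ∀ u, G.degree u ≤ 1 + (if G.Adj w u then 1 else 0) +
        ((if u = v then n - 3 else 0) + if u = w then G.degree w else 0) := by
      intro u
      by_cases h1 : u = v
      · subst h1; rw [hv]; simp only [if_true]; omega
      by_cases h2 : u = w
      · subst h2; simp only [if_true]; omega
      have hs : G.neighborFinset u ⊆ if G.Adj w u then {v, w} else {v} := by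
        intro a ha
        rw [SimpleGraph.mem_neighborFinset] at ha
        rcases hNu u h1 h2 ha with rfl | rfl
        · split_ifs <;> simp
        · simp [ha.symm]
      have := Finset.card_le_card hs
      rw [SimpleGraph.card_neighborFinset_eq_degree] at this
      split_ifs at this ⊢ <;> simp_all [Finset.card_pair hwv.symm]
    have h := Finset.sum_le_sum fun u (_ : u ∈ Finset.univ) => hdeg u
    have hsw : ∑ u, (if G.Adj w u then 1 else 0) = G.degree w := by
      rw [← SimpleGraph.card_neighborFinset_eq_degree, SimpleGraph.neighborFinset_eq_filter,
        Finset.card_filter]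
    rw [G.sum_degrees_eq_twice_card_edges, hG.2] at h
    simp only [Finset.sum_add_distrib, hsw, Finset.sum_ite_eq', Finset.mem_univ, if_true,
      Finset.sum_const, Finset.card_univ, smul_eq_mul, mul_one] at h
    omega
  obtain ⟨y, z, hyz, hN⟩ := Finset.card_eq_two.mp
    ((SimpleGraph.card_neighborFinset_eq_degree G w).trans (le_antisymm hwle hwge))
  have hNw : ∀ a, G.Adj w a ↔ a = y ∨ a = z := fun a => by
    rw [← SimpleGraph.mem_neighborFinset, hN]; simp
  have hwy := (hNw y).2 (.inl rfl)
  have hwz := (hNw z).2 (.inr rfl)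
  have hyv : y ≠ v := by rintro rfl; exact hvw hwy.symm
  have hzv : z ≠ v := by rintro rfl; exact hvw hwz.symm
  have hvy := hadj hyv hwy.ne'
  have hvz := hadj hzv hwz.ne'
  have hnyz : ¬ G.Adj y z := not_triangle_of_isBipartite hb hvy hvz
  refine nonempty_iso_cycleWithPendents ![v, y, w, z] ?_ (by omega) ?_ ?_ ?_
  · intro i j
    fin_cases i <;> fin_cases j <;>
      simp [hyv, hyv.symm, hzv, hzv.symm, hwv, hwv.symm, hwy.ne, hwy.ne', hwz.ne, hwz.ne', hyz,
        hyz.symm]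
  · have hc : ∀ i j : Fin 4, (SimpleGraph.cycleGraph 4).Adj i j ↔ i.val % 2 ≠ j.val % 2 := by
      decide
    intro i j
    rw [hc]
    fin_cases i <;> fin_cases j <;>
      simp [hvy, hvy.symm, hvz, hvz.symm, hwy, hwy.symm, hwz, hwz.symm, hvw, hnyz,
        mt G.adj_symm hvw, mt G.adj_symm hnyz]
  · intro i p hp
    obtain ⟨h1, h2, h3, h4⟩ : p ≠ v ∧ p ≠ y ∧ p ≠ w ∧ p ≠ z := ⟨fun h => hp ⟨0, h.symm⟩,
      fun h => hp ⟨1, h.symm⟩, fun h => hp ⟨2, h.symm⟩, fun h => hp ⟨3, h.symm⟩⟩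
    have hy : ¬ G.Adj y p := fun h => (hNu y hyv hwy.ne' h).elim h1 h3
    have hz : ¬ G.Adj z p := fun h => (hNu z hzv hwz.ne' h).elim h1 h3
    have hw : ¬ G.Adj w p := fun h => ((hNw p).1 h).elim h2 h4
    fin_cases i <;> simp [hadj h1 h3, hy, hz, hw]
  · intro p hp q hq h
    refine (hNu p (fun h => hp ⟨0, h.symm⟩) (fun h => hp ⟨2, h.symm⟩) h).elim
      (fun h => hq ⟨0, h.symm⟩) (fun h => hq ⟨2, h.symm⟩)

end Characterization

/-! ### Strict inequality away from the extremal graphs -/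

section Comparison

variable {V : Type*} [Fintype V] [DecidableEq V] {G : SimpleGraph V} [DecidableRel G.Adj]

theorem IsUnicyclic.sum_degree_sq (hG : IsUnicyclic G) (hV : 4 ≤ Fintype.card V) :
    ∑ v, (G.degree v : ℝ) ^ 2 =
      ((∑ v, (G.degree v - 1) ^ 2 : ℕ) : ℝ) + 3 * Fintype.card V := by
  have h := hG.sum_degree_sub_one hV
  have hv : ∀ v, G.degree v ^ 2 = (G.degree v - 1) ^ 2 + (2 * (G.degree v - 1) + 1) := fun v => by
    obtain ⟨d, hd⟩ : ∃ d, G.degree v = d + 1 :=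
      ⟨G.degree v - 1, (Nat.sub_add_cancel (hG.degree_pos hV v)).symm⟩
    rw [hd, Nat.add_sub_cancel]
    ring
  have : ∑ v, G.degree v ^ 2 = ∑ v, (G.degree v - 1) ^ 2 + 3 * Fintype.card V := by
    rw [Finset.sum_congr rfl fun v _ => hv v]
    simp only [Finset.sum_add_distrib, ← Finset.mul_sum, h, Finset.sum_const, Finset.card_univ,
      smul_eq_mul, mul_one]
    ring
  exact_mod_cast this

theorem IsUnicyclic.pair_degree_sub_one_le (hG : IsUnicyclic G) (hV : 4 ≤ Fintype.card V)
    {u v : V} (huv : u ≠ v) : G.degree u - 1 + (G.degree v - 1) ≤ Fintype.card V - 1 := by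
  have h := degree_add_degree_le (G := G) huv
  rw [hG.2] at h
  have h' : G.degree u + G.degree v ≤ Fintype.card V + 1 := by
    exact_mod_cast h.trans (add_le_add le_rfl (adjMatrix_le_one G u v))
  have := hG.degree_pos hV u
  have := hG.degree_pos hV v
  omega

theorem IsUnicyclic.triple_degree_sub_one_le (hG : IsUnicyclic G) (hb : G.IsBipartite)
    (hV : 4 ≤ Fintype.card V) {u v w : V} (huv : u ≠ v) (huw : u ≠ w) (hvw : v ≠ w) :
    G.degree u - 1 + (G.degree v - 1) + (G.degree w - 1) ≤ Fintype.card V - 1 := by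
  have h := degree_add_degree_add_degree_le hb huv huw hvw
  rw [hG.2] at h
  have h' : G.degree u + G.degree v + G.degree w ≤ Fintype.card V + 2 := by
    exact_mod_cast h
  have := hG.degree_pos hV u
  have := hG.degree_pos hV v
  have := hG.degree_pos hV w
  omega

theorem IsUnicyclic.ER_le (hG : IsUnicyclic G) (hV : 4 ≤ Fintype.card V) {n Y M₄ M₅ : ℝ}
    (hn : (Fintype.card V : ℝ) = n)
    (hY : ∀ a, ∑ b, (G.adjMatrix ℝ * G.adjMatrix ℝ) a b ≤ Y) (hYn : Y < n ^ 2)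
    (h4 : (G.adjMatrix ℝ ^ 4).trace ≤ M₄) (h5 : (G.adjMatrix ℝ ^ 5).trace ≤ M₅) :
    ER G ≤ 1 + 2 * n / n ^ 3 + (G.adjMatrix ℝ ^ 3).trace / n ^ 4 +
      (n * M₄ + M₅) / (n ^ 4 * (n ^ 2 - Y)) := by
  have hpos : 0 < n := by rw [← hn]; exact_mod_cast (by omega : 0 < Fintype.card V)
  have h := ER_le_of_row_sum_sq_le G hn hpos hY hYn
  have h2 : (G.adjMatrix ℝ ^ 2).trace = 2 * n := by
    rw [trace_sq_eq]
    simp only [sum_adjMatrix_row, sum_degree_real, hG.2, hn]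
  rw [h2] at h
  have hd : 0 < n ^ 4 * (n ^ 2 - Y) := mul_pos (by positivity) (by linarith)
  refine h.trans (add_le_add le_rfl ?_)
  gcongr

theorem IsUnicyclic.ER_lt_ER_X (hG : IsUnicyclic G) {n : ℕ} (hn : 4 ≤ n)
    (hV : Fintype.card V = n) (hΔ : ∀ v, G.degree v ≠ n - 1) : ER G < ER (X n) := by
  have hV4 : 4 ≤ Fintype.card V := by omega
  have hnR : (Fintype.card V : ℝ) = n := by rw [hV]
  have hn4 : (4 : ℝ) ≤ n := by exact_mod_cast hn
  obtain ⟨c, hc, h3, h4, h5, hY⟩ := hG.moment_bounds hnR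
  have hx : ∀ v, G.degree v - 1 ≤ n - 3 := fun v => by
    have := G.degree_lt_card_verts v
    have := hΔ v
    omega
  have hsum := hG.sum_degree_sub_one hV4
  have hQ : ∑ v, (G.degree v - 1) ^ 2 ≤ (n - 3) ^ 2 + 5 :=
    sum_sq_le_of_le_sub_three (by omega) hx fun u v huv => by
      have := hG.pair_degree_sub_one_le hV4 huv
      omega
  rw [hG.sum_degree_sq hV4, hnR] at h4
  have hQR : ((∑ v, (G.degree v - 1) ^ 2 : ℕ) : ℝ) ≤ ((n : ℝ) - 3) ^ 2 + 5 := by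
    have : ((n - 3 : ℕ) : ℝ) = (n : ℝ) - 3 := by rw [Nat.cast_sub (by omega)]; norm_num
    rw [← this]
    exact_mod_cast hQ
  rw [ER_X hn]
  rcases hc with rfl | rfl
  · have h := hG.ER_le hV4 hnR hY (by nlinarith)
      (h4.trans (show _ ≤ 2 * (n : ℝ) ^ 2 - 8 * n + 36 by nlinarith)) h5
    rw [h3, mul_zero, zero_div, add_zero, add_zero] at h
    exact h.trans_lt (energy_bound_triangleFree hn4)
  · rcases Nat.lt_or_ge 4 n with h5n | h5n
    · have h := hG.ER_le hV4 hnR hY (by nlinarith)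
        (h4.trans (show _ ≤ 2 * (n : ℝ) ^ 2 - 8 * n + 28 by nlinarith)) h5
      rw [h3, mul_one] at h
      exact h.trans_lt (energy_bound_triangle (by exact_mod_cast h5n))
    · obtain rfl : n = 4 := by omega
      -- For `n = 4` all excesses are at most 1, so their squares sum to exactly 4, sharper than the
      -- general bound 6.
      rw [sum_sq_eq_of_le_one hx, hsum, hV] at h4
      have h := hG.ER_le hV4 hnR hY (by norm_num) h4 h5
      rw [h3] at h
      refine h.trans_lt ?_
      norm_num

theorem IsUnicyclic.ER_lt_ER_XTilde (hG : IsUnicyclic G) (hb : G.IsBipartite) {n : ℕ}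
    (hn : 4 ≤ n) (hV : Fintype.card V = n) (hΔ : ∀ v, G.degree v ≠ n - 2) :
    ER G < ER (XTilde n) := by
  have hV4 : 4 ≤ Fintype.card V := by omega
  have hnR : (Fintype.card V : ℝ) = n := by rw [hV]
  have hn4 : (4 : ℝ) ≤ n := by exact_mod_cast hn
  obtain ⟨c, -, h3, h4, -, hY⟩ := hG.moment_bounds hnR
  have h3' := trace_pow_eq_zero_of_isBipartite hb (show Odd 3 by decide)
  have h5 := (trace_pow_eq_zero_of_isBipartite hb (show Odd 5 by decide)).le
  obtain rfl : c = 0 := by linarith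
  have hx : ∀ v, G.degree v - 1 ≤ n - 4 := fun v => by
    have := G.degree_lt_card_verts v
    have := hΔ v
    have := hG.degree_ne_of_isBipartite hb hV4 v
    omega
  have hsum := hG.sum_degree_sub_one hV4
  have hQ : ∑ v, (G.degree v - 1) ^ 2 ≤ (n - 4) ^ 2 + 6 :=
    sum_sq_le_of_le_sub_four (by omega) hx
      (fun u v huv => by
        have := hG.pair_degree_sub_one_le hV4 huv
        omega)
      (fun u v w huv huw hvw => by
        have := hG.triple_degree_sub_one_le hb hV4 huv huw hvw
        omega)
  rw [hG.sum_degree_sq hV4, hnR] at h4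
  rw [ER_XTilde hn]
  rcases Nat.lt_or_ge 5 n with h6 | h6
  · have hQR : ((∑ v, (G.degree v - 1) ^ 2 : ℕ) : ℝ) ≤ ((n : ℝ) - 4) ^ 2 + 6 := by
      have : ((n - 4 : ℕ) : ℝ) = (n : ℝ) - 4 := by rw [Nat.cast_sub (by omega)]; norm_num
      rw [← this]
      exact_mod_cast hQ
    have h := hG.ER_le hV4 hnR hY (by nlinarith)
      (h4.trans (show _ ≤ 2 * (n : ℝ) ^ 2 - 12 * n + 52 by nlinarith)) h5
    rw [h3', zero_div, add_zero, add_zero, add_zero] at h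
    exact h.trans_lt (energy_bound_bipartite (by exact_mod_cast h6))
  -- For `n ≤ 5` the excesses are again 0 or 1; for `n = 4` they would all vanish, contradicting
  -- their sum.
  · rw [sum_sq_eq_of_le_one fun v => (hx v).trans (by omega), hsum, hV] at h4
    have hn5 : n ≠ 4 := by
      rintro rfl
      have : ∑ v, (G.degree v - 1) = 0 := Finset.sum_eq_zero fun v _ => Nat.le_zero.mp (hx v)
      omega
    obtain rfl : n = 5 := by omega
    have h := hG.ER_le hV4 hnR hY (by norm_num) h4 h5
    rw [h3'] at h
    refine h.trans_lt ?_
    norm_num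

end Comparison

end ResolventEnergy

theorem mainTheorem1 {V : Type*} [Fintype V] [DecidableEq V] (G : SimpleGraph V)
    [DecidableRel G.Adj] (n : ℕ) (hn : 4 ≤ n) (hV : Fintype.card V = n)
    (hG : ResolventEnergy.IsUnicyclic G) :
    (ResolventEnergy.ER G ≤ ResolventEnergy.ER (ResolventEnergy.X n) ∧
      (ResolventEnergy.ER G = ResolventEnergy.ER (ResolventEnergy.X n) ↔
        Nonempty (G ≃g ResolventEnergy.X n))) ∧
    (G.IsBipartite →
      ResolventEnergy.ER G ≤ ResolventEnergy.ER (ResolventEnergy.XTilde n) ∧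
      (ResolventEnergy.ER G = ResolventEnergy.ER (ResolventEnergy.XTilde n) ↔
        Nonempty (G ≃g ResolventEnergy.XTilde n))) := by
  refine ⟨?_, fun hb => ?_⟩
  · by_cases h : ∃ v, G.degree v = n - 1
    · obtain ⟨v, hv⟩ := h
      have hiso := hG.nonempty_iso_X hn hV hv
      have heq := ResolventEnergy.ER_congr hiso.some
      exact ⟨heq.le, iff_of_true heq hiso⟩
    · push Not at h
      have hlt := hG.ER_lt_ER_X hn hV h
      exact ⟨hlt.le, iff_of_false hlt.ne fun ⟨e⟩ => hlt.ne (ResolventEnergy.ER_congr e)⟩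
  · by_cases h : ∃ v, G.degree v = n - 2
    · obtain ⟨v, hv⟩ := h
      have hiso := hG.nonempty_iso_XTilde hb hn hV hv
      have heq := ResolventEnergy.ER_congr hiso.some
      exact ⟨heq.le, iff_of_true heq hiso⟩
    · push Not at h
      have hlt := hG.ER_lt_ER_XTilde hb hn hV h
      exact ⟨hlt.le, iff_of_false hlt.ne fun ⟨e⟩ => hlt.ne (ResolventEnergy.ER_congr e)⟩
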